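/- **Setting.** Each robot $i\in\{1,\dots,N\}$ has a weighted transition system on the regions $r_1,\dots,r_W$, with initial region $q_i^0$, transition relation $\to_i$ and weights $w_i\ge 0$. A team state is $q=(q_1,\dots,q_N)$, and $q\to q'$ iff $q_i\to_i q_i'$ for all $i$; $w(q,q')=\sum_i w_i(q_i,q_i')$; the label $L(q)$ is the set of the propositions $\pi_i^{r_j}$ with $q_i=r_j$. Let $\phi$ be an LTL formula over these propositions, and let $B$ be a nondeterministic Büchi automaton with finite state set $Q_B$, initial states $Q_B^0$ and accepting states $Q_B^F$, that accepts exactly the words of $\phi$. In the product $P$ there is a transition $(q,b)\to_P(q',b')$ iff $q\to q'$ and $b\xrightarrow{L(q)}b'$ in $B$; its weight is $w(q,q')$. A plan $\tau=\tau^{\rm pre}[\tau^{\rm suf}]^\omega$ consists of the team projections of a finite path of $P$ from an initial state $(q^0,b_0)$, $b_0\in Q_B^0$, to some $f$ with automaton part in $Q_B^F$, and of a cycle around $f$ with at least one transition. With $\hat J$ the total weight of a finite path and $\beta\in[0,1]$ fixed, $J(\tau)=\beta\hat J(\tau^{\rm pre})+(1-\beta)\hat J(\tau^{\rm suf})$.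 A plan is optimal if $\tau\models\phi$ and $J(\tau)\le J(\tau')$ for all plans $\tau'\models\phi$. **Bias.** A set of propositions is a feasible symbol if it puts no robot in two regions. Let $d(b,b')\in\mathbb N\cup\{\infty\}$ be the number of edges of a shortest path from $b$ to $b'$ in the graph on $Q_B$ with an edge for each transition enabled by a feasible symbol. For $b_0\in Q_B^0$, a feasible final state is an $F\in Q_B^F$ with $d(b_0,F)<\infty$ that lies on a nontrivial cycle of this graph. A biased draw from a finite set $T\ne\emptyset$ with favoured subset $A$ and parameter $p$ has probability $p/|A|$ at each point of $A$ and $(1-p)/|T\setminus A|$ at each point of $T\setminus A$; it is uniform on $T$ if $A=\emptyset$ or $A=T$. **Tree construction.** The tree starts with a given root. The cost of a node is the weight of the tree path from the root to it. Each iteration $n$, with current tree node set $V$ and target state $g\in Q_B$, does the following. 1. Draw $(q,b)\in V$ by a biased draw with parameter $p_{\rm rand}^n$ that favours the nodes with minimal $d(\cdot,g)$. Let $R$ be the set of $b'$ with $b\xrightarrow{L(q)}b'$, and let $M$ be the set of those $b'\in R$ with minimal $d(\cdot,g)$ over $R$ for which $D(b')=\{b'': b'\to b''\text{ is an edge of the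 graph},\ d(b'',g)=d(b',g)-1<\infty\}$ is nonempty. 2. If $R=\emptyset$, no sample is taken. If $M\neq\emptyset$, draw $b'\in M$ and $b''\in D(b')$ uniformly, take the feasible symbol fixed for $(b',b'')$, and give each robot $i$ as destination the region in which the symbol puts it, if any; in a suffix tree with root $\rho$ whose automaton part lies in $D(b')$, the remaining robots get their position in $\rho$ as destination. Draw $q_i^{\rm new}$ independently over $i$ from $\{x: q_i\to_i x\}$ by a biased draw with parameter $p_{\rm new}^n$ favouring the second state of a fixed shortest path from $q_i$ to the destination (uniformly if there is no destination or no such second state). If $M=\emptyset$, either no sample is taken or every $q_i^{\rm new}$ is drawn independently and uniformly from $\{x:q_i\to_i x\}$. If some robot has no transition, no sample is taken. 3. If a sample $q^{\rm new}$ was taken, then for every $b\in Q_B$ in turn: if $(q^{\rm new},b)$ is not a node and some node has a transition to it, add it below the node that gives it the least cost (extend); if it is now a node, make it the parent of each of its successors in the tree whose cost this strictly decreases (rewire). The parameters $p^n_{\rm rand},p^n_{\rm new}$, the target and the choice between the two options for $M=\emptyset$ may change with $n$ and depend on the current tree ($p_{\rm new}^n$ also on the drawn node and on the robot). Assume that for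 some $\varepsilon>0$ all values $p_{\rm rand}^n,p_{\rm new}^n$ lie in $[\varepsilon,1-\varepsilon]$, and that in every tree construction there are infinitely many iterations $n$ in which, whatever the current tree, a sample is drawn also when $M=\emptyset$. **STyLuS\*.** For each $b_0\in Q_B^0$ that has a feasible final state, a prefix tree with root $(q^0,b_0)$ is built with $n^{\rm pre}_{\max}$ iterations, with feasible final states of $b_0$ as targets. For each node $\rho$ of it with accepting automaton part, the prefix is the tree path to $\rho$. A suffix tree with root $\rho$ and target the automaton part of $\rho$ is built with $n^{\rm suf}_{\max}$ iterations (it is just $\{\rho\}$ if $\rho\to_P\rho$ with weight $0$), and the suffix is a cheapest cycle consisting of a tree path from $\rho$ to a node $s$ with $s\to_P\rho$ and this last transition, if such a node exists. The output is a plan of least cost $J$ among those obtained over all $b_0$ and $\rho$. As the iteration bounds grow, the same random tree sequences are continued. **Theorem.** Assume that some infinite team path from $q^0$ satisfies $\phi$ (in particular, that an optimal plan exists). Then STyLuS\* is 1. probabilistically complete: with probability $1$, for all sufficiently large $n^{\rm pre}_{\max}$ and $n^{\rm suf}_{\max}$ it outputs a plan, and its output satisfies $\tau\models\phi$; 2.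 asymptotically optimal: with probability $1$, for all sufficiently large $n^{\rm pre}_{\max}$ and $n^{\rm suf}_{\max}$ it outputs a plan, and its output is an optimal plan. -/

import Mathlib

open MeasureTheory Filter
open scoped ENNReal NNReal

noncomputable section

namespace Stylus

/-! ### Linear temporal logic over infinite words -/

/-- LTL formulas over a set `A` of atomic propositions. -/
inductive LTL (A : Type) : Type
  | tt : LTL A
  | atom : A → LTL A
  | neg : LTL A → LTL A
  | and : LTL A → LTL A → LTL A
  | next : LTL A → LTL A
  | untl : LTL A → LTL A → LTL A

/-- Satisfaction of an LTL formula by an infinite word over `2^A`. -/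
def LTL.Sat {A : Type} : LTL A → (ℕ → Set A) → Prop
  | .tt, _ => True
  | .atom a, σ => a ∈ σ 0
  | .neg φ, σ => ¬ φ.Sat σ
  | .and φ ψ, σ => φ.Sat σ ∧ ψ.Sat σ
  | .next φ, σ => φ.Sat (fun n => σ (n + 1))
  | .untl φ ψ, σ =>
      ∃ k, ψ.Sat (fun n => σ (n + k)) ∧ ∀ j < k, φ.Sat (fun n => σ (n + j))

/-! ### Nondeterministic Büchi automata -/

/-- A nondeterministic Büchi automaton over the alphabet `2^A`. -/
structure NBA (A QB : Type) where
  init : Set QB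
  trans : QB → Set A → QB → Prop
  final : Set QB

/-- A word is accepted if some run on it visits the accepting states infinitely often. -/
def NBA.Accepts {A QB : Type} (B : NBA A QB) (σ : ℕ → Set A) : Prop :=
  ∃ ρ : ℕ → QB, ρ 0 ∈ B.init ∧ (∀ k, B.trans (ρ k) (σ k) (ρ (k + 1))) ∧
    ∃ᶠ k in atTop, ρ k ∈ B.final

/-! ### Transition systems -/

/-- The weighted transition system of one robot; the state `j : Fin W` says that the robot is in
region `r_j`. -/
structure WTS (W : ℕ) where
  init : Fin W
  trans : Fin W → Fin W → Prop
  weight : Fin W → Fin W → ℝ≥0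

/-- Atomic propositions: `(i, j)` says that robot `i` is in region `r_j`. -/
abbrev AP (N W : ℕ) : Type := Fin N × Fin W

/-- States of the product transition system. -/
abbrev QPTS (N W : ℕ) : Type := Fin N → Fin W

/-- States of the product Büchi automaton. -/
abbrev QP (N W : ℕ) (QB : Type) : Type := QPTS N W × QB

section Product

variable {N W : ℕ} {QB : Type} (S : Fin N → WTS W) (B : NBA (AP N W) QB)

def ptsInit : QPTS N W := fun i => (S i).init

def ptsTrans (q q' : QPTS N W) : Prop := ∀ i, (S i).trans (q i) (q' i)

def ptsWeight (q q' : QPTS N W) : ℝ := ∑ i, ((S i).weight (q i) (q' i) : ℝ)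

/-- The observation of a product state: the propositions that are true there. -/
def label (q : QPTS N W) : Set (AP N W) := {a | q a.1 = a.2}

/-- Infinite paths of the product transition system. -/
def IsPTSPath (τ : ℕ → QPTS N W) : Prop :=
  τ 0 = ptsInit S ∧ ∀ k, ptsTrans S (τ k) (τ (k + 1))

/-- `τ ⊨ φ`: the trace of `τ` is a word of `φ`. -/
def Models (τ : ℕ → QPTS N W) (φ : LTL (AP N W)) : Prop := φ.Sat (fun k => label (τ k))

def pbaTrans (p p' : QP N W QB) : Prop :=
  ptsTrans S p.1 p'.1 ∧ B.trans p.2 (label p.1) p'.2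

def pbaWeight (p p' : QP N W QB) : ℝ := ptsWeight S p.1 p'.1

end Product

/-- The cost of a finite path: the sum of the weights of its consecutive pairs of states. -/
def pathCost {α : Type} (w : α → α → ℝ) (l : List α) : ℝ := (List.zipWith w l l.tail).sum

/-! ### Plans in prefix-suffix form -/

/-- A team plan `pre [suf]^ω`. The list `pre` ends at the state at which the cycle `suf` starts,
and `suf` lists that state twice, at its beginning and at its end. -/
structure Plan (N W : ℕ) where
  pre : List (QPTS N W)
  suf : List (QPTS N W)

section Plans

variable {N W : ℕ} {QB : Type} (S : Fin N → WTS W) (B : NBA (AP N W) QB)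

/-- The infinite sequence of team states of a plan: first `pre`, then the cycle `suf`
forever (the state shared by the end of `pre` and the start of `suf` is visited once). -/
def Plan.run (P : Plan N W) (n : ℕ) : QPTS N W :=
  if n < P.pre.length then P.pre.getD n (ptsInit S)
  else P.suf.getD ((n - P.pre.length) % (P.suf.length - 1) + 1) (ptsInit S)

/-- The plan is the projection of a path of the product Büchi automaton from an initial state to
an accepting state, and of a cycle around that accepting state. -/
def IsPrefixSuffix (P : Plan N W) : Prop :=
  ∃ (ppre psuf : List (QP N W QB)) (b₀ : QB) (f : QP N W QB),
    P.pre = ppre.map Prod.fst ∧ P.suf = psuf.map Prod.fst ∧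
    b₀ ∈ B.init ∧ f.2 ∈ B.final ∧
    ppre.head? = some (ptsInit S, b₀) ∧ ppre.getLast? = some f ∧ ppre.IsChain (pbaTrans S B) ∧
    2 ≤ psuf.length ∧ psuf.head? = some f ∧ psuf.getLast? = some f ∧
    psuf.IsChain (pbaTrans S B)

/-- `J(τ) = β Ĵ(τ^pre) + (1 - β) Ĵ(τ^suf)`. -/
def Plan.cost (β : ℝ) (P : Plan N W) : ℝ :=
  β * pathCost (ptsWeight S) P.pre + (1 - β) * pathCost (ptsWeight S) P.suf

/-- The plan is executable by the team, is in prefix-suffix form, and satisfies `φ`. -/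
def IsFeasiblePlan (φ : LTL (AP N W)) (P : Plan N W) : Prop :=
  IsPrefixSuffix S B P ∧ IsPTSPath S (P.run S) ∧ Models (P.run S) φ

/-- The plan is feasible and minimizes the cost among all feasible plans. -/
def IsOptimalPlan (φ : LTL (AP N W)) (β : ℝ) (P : Plan N W) : Prop :=
  IsFeasiblePlan S B φ P ∧ ∀ P' : Plan N W, IsFeasiblePlan S B φ P' → P.cost S β ≤ P'.cost S β

end Plans

/-! ### Shortest paths in directed graphs -/

/-- `b` can be reached from `a` in exactly `n` steps. -/
def StepsIn {α : Type} (r : α → α → Prop) : ℕ → α → α → Prop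
  | 0, a, b => a = b
  | n + 1, a, b => ∃ c, r a c ∧ StepsIn r n c b

/-- The number of edges of a shortest path, `⊤` if there is no path. -/
def hopDist {α : Type} (r : α → α → Prop) (a b : α) : ℕ∞ :=
  sInf {m : ℕ∞ | ∃ n : ℕ, m = n ∧ StepsIn r n a b}

open scoped Classical in
/-- The second state of a (fixed) shortest path from `a` to `b`; it is undefined if there is no
path or if `a = b`. -/
def second {α : Type} (r : α → α → Prop) (a b : α) : Option α :=
  if h : ∃ c, r a c ∧ hopDist r a b ≠ ⊤ ∧ hopDist r c b + 1 = hopDist r a b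
  then some h.choose else none

/-! ### Feasible symbols and the metric on the Büchi automaton -/

section Automaton

variable {N W : ℕ} {QB : Type} (B : NBA (AP N W) QB)

/-- A symbol is feasible if it does not put a robot in two regions. -/
def FeasibleSymbol (σ : Set (AP N W)) : Prop :=
  ∀ i j e, (i, j) ∈ σ → (i, e) ∈ σ → j = e

/-- The feasible symbols that enable a transition from `b` to `b'`. -/
def feasWords (b b' : QB) : Set (Set (AP N W)) := {σ | FeasibleSymbol σ ∧ B.trans b σ b'}

/-- The edges of the pruned automaton. -/
def feasEdge (b b' : QB) : Prop := (feasWords B b b').Nonempty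

def dist (b b' : QB) : ℕ∞ := hopDist (feasEdge B) b b'

/-- Feasible accepting states for the initial state `b₀`: reachable from `b₀`, and on a loop. -/
def IsFeasibleFinal (b₀ f : QB) : Prop :=
  f ∈ B.final ∧ dist B b₀ f ≠ ⊤ ∧ Relation.TransGen (feasEdge B) f f

open scoped Classical in
/-- The symbol that is always used for the pair `b`, `b'`. -/
def symbol (b b' : QB) : Set (AP N W) :=
  if h : (feasWords B b b').Nonempty then h.some else ∅

open scoped Classical in
/-- The region where robot `i` has to be for `σ` to be generated, if there is one. -/
def goalRegion (σ : Set (AP N W)) (i : Fin N) : Option (Fin W) :=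
  if h : ∃ j, (i, j) ∈ σ then some h.choose else none

end Automaton

/-! ### Trees -/

/-- A rooted tree in a graph: its nodes, and the parent of each node but the root. -/
structure Tree (Q : Type) where
  nodes : Finset Q
  parent : Q → Option Q

section Trees

variable {Q : Type}

def Tree.init (root : Q) : Tree Q := ⟨{root}, fun _ => none⟩

/-- The path that ends at `q` found by tracing at most `n` parents. -/
def tracePath (parent : Q → Option Q) : ℕ → Q → List Q
  | 0, q => [q]
  | n + 1, q =>
    match parent q with
    | none => [q]
    | some q' => tracePath parent n q' ++ [q]

/-- The path in the tree from the root to `q`. -/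
def Tree.findPath (t : Tree Q) (q : Q) : List Q := tracePath t.parent t.nodes.card q

/-- The cost of reaching `q` from the root through the tree. -/
def Tree.cost (w : Q → Q → ℝ) (t : Tree Q) (q : Q) : ℝ := pathCost w (t.findPath q)

variable (r : Q → Q → Prop) (w : Q → Q → ℝ)

open scoped Classical in
/-- Extend the tree towards a new state: among the nodes with a transition to it, the one that
gives it the smallest cost becomes its parent; without such nodes nothing happens. -/
def Tree.extend (t : Tree Q) (q : Q) : Tree Q :=
  if h : (t.nodes.filter fun p => r p q).Nonempty then
    ⟨insert q t.nodes,
      Function.update t.parent q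
        (some (Finset.exists_min_image _ (fun p => t.cost w p + w p q) h).choose)⟩
  else t

open scoped Classical in
/-- Rewire: every node that is reachable in one hop from `q`, one after the other, gets `q` as its
parent if that strictly decreases its cost. -/
def Tree.rewire (t : Tree Q) (q : Q) : Tree Q :=
  (t.nodes.filter fun p => r q p).toList.foldl
    (fun s p =>
      if s.cost w q + w q p < s.cost w p
      then ⟨s.nodes, Function.update s.parent p (some q)⟩ else s) t

end Trees

/-! ### Sampling distributions -/

open scoped Classical in
/-- The density on a nonempty finite set `T` that gives probability `p`, uniformly shared, to `A`
and probability `1 - p`, uniformly shared, to the rest of `T`; uniform on `T` if `A` or the rest is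
empty. -/
def biasedDensity {α : Type} (p : unitInterval) (A T : Finset α) (x : α) : ℝ≥0∞ :=
  if (T ∩ A).Nonempty ∧ (T \ A).Nonempty then
    if x ∈ T ∩ A then ENNReal.ofReal p / (T ∩ A).card
    else if x ∈ T \ A then ENNReal.ofReal (1 - p) / (T \ A).card
    else 0
  else if x ∈ T then 1 / T.card else 0

theorem sum_ite_mem_div {α : Type} [Fintype α] [DecidableEq α] (c : ℝ≥0∞) (T : Finset α)
    (hT : T.Nonempty) : (∑ x, if x ∈ T then c / (T.card : ℝ≥0∞) else 0) = c := by
  rw [Finset.sum_ite_mem, Finset.univ_inter, Finset.sum_const, nsmul_eq_mul]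
  exact ENNReal.mul_div_cancel (by simpa using hT.ne_empty) (by simp)

theorem sum_biasedDensity {α : Type} [Fintype α] (p : unitInterval) (A T : Finset α)
    (hT : T.Nonempty) : ∑ x, biasedDensity p A T x = 1 := by
  classical
  by_cases h : (T ∩ A).Nonempty ∧ (T \ A).Nonempty
  · have hx : ∀ x, biasedDensity p A T x =
        (if x ∈ T ∩ A then ENNReal.ofReal p / ((T ∩ A).card : ℝ≥0∞) else 0) +
        (if x ∈ T \ A then ENNReal.ofReal (1 - p) / ((T \ A).card : ℝ≥0∞) else 0) := by
      intro x
      unfold biasedDensity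
      rw [if_pos (by convert h)]
      by_cases h1 : x ∈ T <;> by_cases h2 : x ∈ A <;> simp [h1, h2]
    rw [Finset.sum_congr rfl fun x _ => hx x, Finset.sum_add_distrib,
      sum_ite_mem_div _ _ h.1, sum_ite_mem_div _ _ h.2,
      ← ENNReal.ofReal_add p.2.1 (by linarith [p.2.2])]
    simp
  · have hx : ∀ x, biasedDensity p A T x = if x ∈ T then 1 / (T.card : ℝ≥0∞) else 0 := by
      intro x
      unfold biasedDensity
      rw [if_neg (by convert h)]
    rw [Finset.sum_congr rfl fun x _ => hx x, sum_ite_mem_div _ _ hT]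

def biased {α : Type} [Fintype α] (p : unitInterval) (A T : Finset α) (hT : T.Nonempty) : PMF α :=
  PMF.ofFintype (biasedDensity p A T) (sum_biasedDensity p A T hT)

/-- The joint distribution of independent choices. -/
def indep {n : ℕ} {α : Type} [Fintype α] (f : Fin n → PMF α) : PMF (Fin n → α) :=
  PMF.ofFintype (fun x => ∏ i, f i (x i)) (by
    classical
    have h := Finset.prod_univ_sum (fun _ : Fin n => (Finset.univ : Finset α))
      (fun i a => (f i) a)
    rw [Fintype.piFinset_univ] at h
    rw [← h]
    refine Finset.prod_eq_one fun i _ => ?_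
    rw [← tsum_fintype (L := .unconditional α)]
    exact (f i).tsum_coe)

/-! ### The sampling step -/

section Algorithm

variable {N W : ℕ} {QB : Type} [Fintype QB] (S : Fin N → WTS W) (B : NBA (AP N W) QB)

open scoped Classical in
/-- The nodes whose automaton part is closest to `g`. -/
def dMin (t : Tree (QP N W QB)) (g : QB) : Finset (QP N W QB) :=
  t.nodes.filter fun p => ∀ p' ∈ t.nodes, dist B p.2 g ≤ dist B p'.2 g

open scoped Classical in
/-- `R_B`: the automaton states that can be reached in one hop from `p.2` under the observation
at `p.1`. -/
def reachB (p : QP N W QB) : Finset QB :=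
  Finset.univ.filter fun b => B.trans p.2 (label p.1) b

open scoped Classical in
/-- `R_B^min`: the states of `R_B` that are closest to `g`. -/
def reachBMin (g : QB) (p : QP N W QB) : Finset QB :=
  (reachB B p).filter fun b => ∀ b' ∈ reachB B p, dist B b g ≤ dist B b' g

open scoped Classical in
/-- `R_B^decr`: the states one feasible transition after `b` that are closer to `g`. -/
def decr (g b : QB) : Finset QB :=
  Finset.univ.filter fun b' => feasEdge B b b' ∧ dist B b' g ≠ ⊤ ∧ dist B b' g + 1 = dist B b g

open scoped Classical in
/-- The set `M`. -/
def candidates (g : QB) (p : QP N W QB) : Finset QB :=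
  (reachBMin B g p).filter fun b => (decr B g b).Nonempty

open scoped Classical in
/-- The states that robot `i` can reach in one hop from `j`. -/
def reachWTS (i : Fin N) (j : Fin W) : Finset (Fin W) :=
  Finset.univ.filter fun j' => (S i).trans j j'

open scoped Classical in
/-- Draw the next state of every robot, independently, among the states reachable in one hop.
A robot `i` with `dest i = some j` takes with probability `pNew i` the second state of its
shortest path to `j`; its distribution is uniform if `dest i = none` or that state is undefined. -/
def drawNew (pNew : Fin N → unitInterval) (q : QPTS N W) (dest : Fin N → Option (Fin W)) :
    PMF (Option (QPTS N W)) :=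
  if h : ∀ i, (reachWTS S i (q i)).Nonempty then
    (indep fun i => biased (pNew i)
      ((dest i).bind fun j => second (S i).trans (q i) j).toFinset
      (reachWTS S i (q i)) (h i)).map some
  else PMF.pure none

open scoped Classical in
/-- Where robot `i` should go, given the two selected automaton states. In a suffix tree with root
`ρ`, when the automaton part of `ρ` is one hop after `b`, a robot without a region prescribed by
the symbol should go to its position in `ρ`. -/
def destination (g : QB) (root? : Option (QP N W QB)) (b b' : QB) (i : Fin N) :
    Option (Fin W) :=
  match goalRegion (symbol B b b') i with
  | some j => some j
  | none =>
    match root? with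
    | some ρ => if ρ.2 ∈ decr B g b then some (ρ.1 i) else none
    | none => none

open scoped Classical in
/-- The distribution of the sampled state `q_PTS^new` (`none`: no sample is taken), when sampling
is biased towards the automaton state `g`. If the set `M` is empty, no sample is taken if `skip`
holds, and otherwise every robot moves uniformly at random. -/
def sample (g : QB) (root? : Option (QP N W QB)) (pRand : unitInterval)
    (pNew : QP N W QB → Fin N → unitInterval) (skip : Prop) (t : Tree (QP N W QB)) :
    PMF (Option (QPTS N W)) :=
  if hV : t.nodes.Nonempty then
    (biased pRand (dMin B t g) t.nodes hV).bind fun p =>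
      if (reachB B p).Nonempty then
        if hM : (candidates B g p).Nonempty then
          (PMF.uniformOfFinset (candidates B g p) hM).bind fun b =>
            if hD : (decr B g b).Nonempty then
              (PMF.uniformOfFinset (decr B g b) hD).bind fun b' =>
                drawNew S (pNew p) p.1 (destination B g root? b b')
            else PMF.pure none
        else if skip then PMF.pure none
        else drawNew S (pNew p) p.1 (fun _ => none)
      else PMF.pure none
  else PMF.pure none

/-! ### Construction of one tree -/

open scoped Classical in
/-- Append every automaton state in turn to the sampled state, and extend and rewire the tree. -/
def update (t : Tree (QP N W QB)) (x : QPTS N W) : Tree (QP N W QB) :=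
  (Finset.univ : Finset QB).toList.foldl
    (fun s b =>
      let s' := if (x, b) ∈ s.nodes then s
        else s.extend (pbaTrans S B) (pbaWeight S) (x, b)
      if (x, b) ∈ s'.nodes then s'.rewire (pbaTrans S B) (pbaWeight S) (x, b) else s') t

/-- The parameters of the sampling step, which may change with the iteration and depend on the
current tree: the probabilities `p_rand` and `p_new` (the latter may also depend on the sampled
node and on the robot), and whether an iteration may end without a sample if `M` is empty. -/
structure SamplingParams (N W : ℕ) (QB : Type) where
  pRand : ℕ → Tree (QP N W QB) → unitInterval
  pNew : ℕ → Tree (QP N W QB) → QP N W QB → Fin N → unitInterval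
  skip : ℕ → Tree (QP N W QB) → Prop

/-- The probabilities stay away from `0` and `1` by `ε`, and there are infinitely many iterations in
which a sample is also taken if `M` is empty. -/
def SamplingParams.Admissible (ε : ℝ) (θ : SamplingParams N W QB) : Prop :=
  (∀ n t, (θ.pRand n t : ℝ) ∈ Set.Icc ε (1 - ε)) ∧
  (∀ n t p i, (θ.pNew n t p i : ℝ) ∈ Set.Icc ε (1 - ε)) ∧
  ∃ᶠ n in atTop, ∀ t, ¬ θ.skip n t

/-- The distribution of the tree after one more iteration. -/
def treeStep (target : ℕ → Tree (QP N W QB) → QB) (root? : Option (QP N W QB))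
    (θ : SamplingParams N W QB) (n : ℕ) (t : Tree (QP N W QB)) : PMF (Tree (QP N W QB)) :=
  (sample S B (target n t) root? (θ.pRand n t) (θ.pNew n t) (θ.skip n t) t).map fun o =>
    match o with
    | some x => update S B t x
    | none => t

end Algorithm

/-- `X` is a random sequence that starts at `x₀` and whose element of index `n + 1`, given the
elements of index at most `n`, is distributed as `κ n (X n)`. -/
structure IsRun {Ω E : Type*} [MeasurableSpace Ω] (ℙ : Measure Ω) (x₀ : E) (κ : ℕ → E → PMF E)
    (X : ℕ → Ω → E) : Prop where
  measurable : ∀ n x, MeasurableSet {ω | X n ω = x}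
  start : ∀ᵐ ω ∂ℙ, X 0 ω = x₀
  law : ∀ (n : ℕ) (x : ℕ → E),
    ℙ {ω | ∀ k ≤ n + 1, X k ω = x k} = ℙ {ω | ∀ k ≤ n, X k ω = x k} * κ n (x n) (x (n + 1))

/-! ### Extraction of the plan -/

section Output

variable {N W : ℕ} {QB : Type} (S : Fin N → WTS W) (B : NBA (AP N W) QB)

/-- `𝒫`: the accepting states in the prefix tree; the tree is not built, and the set is empty, if
there is no feasible accepting state. -/
def goalPre (b₀ : QB) (t : Tree (QP N W QB)) : Set (QP N W QB) :=
  {p | (∃ f, IsFeasibleFinal B b₀ f) ∧ p ∈ t.nodes ∧ p.2 ∈ B.final}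

open scoped Classical in
/-- The suffix tree for the root `ρ`: trivial if `ρ` has a self-transition of zero cost, and
otherwise the sampled tree `t`. -/
def suffixTree (ρ : QP N W QB) (t : Tree (QP N W QB)) : Tree (QP N W QB) :=
  if pbaTrans S B ρ ρ ∧ pbaWeight S ρ ρ = 0 then Tree.init ρ else t

/-- `𝒮`: the nodes of the suffix tree with a transition to the root. -/
def goalSuf (ρ : QP N W QB) (t : Tree (QP N W QB)) : Set (QP N W QB) :=
  {p | p ∈ t.nodes ∧ pbaTrans S B p ρ}

/-- `l` is a cheapest cycle around `ρ` among those that close a path of the suffix tree. -/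
def IsBestCycle (ρ : QP N W QB) (t : Tree (QP N W QB)) (l : List (QP N W QB)) : Prop :=
  ∃ p ∈ goalSuf S B ρ t, l = t.findPath p ++ [ρ] ∧
    ∀ p' ∈ goalSuf S B ρ t,
      pathCost (pbaWeight S) l ≤ pathCost (pbaWeight S) (t.findPath p' ++ [ρ])

/-- The plans obtained from the prefix trees `tpre b₀` and the suffix trees `tsuf b₀ ρ`. -/
def IsCandidatePlan (tpre : QB → Tree (QP N W QB)) (tsuf : QB → QP N W QB → Tree (QP N W QB))
    (P : Plan N W) : Prop :=
  ∃ b₀ ∈ B.init, ∃ ρ ∈ goalPre B b₀ (tpre b₀), ∃ l,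
    IsBestCycle S B ρ (suffixTree S B ρ (tsuf b₀ ρ)) l ∧
    P.pre = ((tpre b₀).findPath ρ).map Prod.fst ∧ P.suf = l.map Prod.fst

/-- The plans that the algorithm may return: candidates of minimal cost. -/
def IsOutput (β : ℝ) (tpre : QB → Tree (QP N W QB))
    (tsuf : QB → QP N W QB → Tree (QP N W QB)) (P : Plan N W) : Prop :=
  IsCandidatePlan S B tpre tsuf P ∧
    ∀ P', IsCandidatePlan S B tpre tsuf P' → P.cost S β ≤ P'.cost S β

end Output

/-- A run of the algorithm: the random prefix tree `Xpre b₀ n` after `n` iterations for each initial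
state `b₀` of the automaton that has a feasible accepting state (sampling is biased towards
`target b₀ n t`), and the random suffix tree `Xsuf b₀ ρ n` after `n` iterations for each possible
root `ρ`. -/
structure IsAlgorithmRun {N W : ℕ} {QB : Type} {Ω : Type*} [Fintype QB] [MeasurableSpace Ω]
    (ℙ : Measure Ω)
    (S : Fin N → WTS W) (B : NBA (AP N W) QB)
    (target : QB → ℕ → Tree (QP N W QB) → QB)
    (θpre : QB → SamplingParams N W QB) (θsuf : QB → QP N W QB → SamplingParams N W QB)
    (Xpre : QB → ℕ → Ω → Tree (QP N W QB))
    (Xsuf : QB → QP N W QB → ℕ → Ω → Tree (QP N W QB)) : Prop where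
  target_feasible : ∀ b₀ ∈ B.init, (∃ f, IsFeasibleFinal B b₀ f) →
    ∀ n t, IsFeasibleFinal B b₀ (target b₀ n t)
  pre : ∀ b₀ ∈ B.init, (∃ f, IsFeasibleFinal B b₀ f) →
    IsRun ℙ (Tree.init (ptsInit S, b₀)) (treeStep S B (target b₀) none (θpre b₀)) (Xpre b₀)
  suf : ∀ b₀ ∈ B.init, ∀ ρ : QP N W QB, ρ.2 ∈ B.final →
    IsRun ℙ (Tree.init ρ) (treeStep S B (fun _ _ => ρ.2) (some ρ) (θsuf b₀ ρ)) (Xsuf b₀ ρ)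

end Stylus

end

noncomputable section

namespace Stylus

/-! ### Costs of finite paths -/

section Paths

variable {Q : Type} {w : Q → Q → ℝ}

/-! Almost surely each tree becomes, after finitely many iterations, a tree of cheapest paths to
everything reachable from its root; both claims then follow deterministically. The point is that the
bias of the sampling only matters through a uniform positive lower bound on its probabilities.

Monotonicity. Order trees by `Tree.Le` (more nodes, no larger costs). Extending and rewiring only
move a tree up this preorder and preserve `Tree.Inv` (`Tree.Inv.update`).

Progress. If a tree violates optimality, Bellman's condition fails along some edge from a node `u`
to a state `v` (`Tree.Inv.isOptimal`). If `v` is missing, sampling the team part of `v` adds it. If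
`v` is present but too expensive, sampling the team part of `u` again rewires `v`; this sample is
available from the tree parent of `u`. Only the root has no parent, and there `root_edge` in the
invariant excludes a violation. So some available sample strictly improves the tree
(`Tree.Inv.exists_improvement`), and in an iteration that does not skip it has probability at least
`sampleBound` (`le_sample`).

Absorption. There are finitely many trees. The expected rank in the preorder is bounded and
nondecreasing, and infinitely often it grows by at least a constant times the probability of not
being optimal yet. Hence the probability of never becoming optimal is zero
(`IsRun.ae_eventually_mem`).

Extraction. A plan is a path of the product to an accepting `f` followed by a cycle at `f`. Since
`β` and `1 - β` are nonnegative, the two parts can be minimized separately for each `f`, and optimal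
trees provide both minima (`OptimalTrees.exists_candidate_le`). Conversely, Büchi acceptance makes
every candidate satisfy the formula (`IsPrefixSuffix.isFeasiblePlan`), and a pigeonhole on an
accepting run shows that plans exist (`exists_isPrefixSuffix`). -/

theorem pathCost_cons_cons (w : Q → Q → ℝ) (a b : Q) (l : List Q) :
    pathCost w (a :: b :: l) = w a b + pathCost w (b :: l) := by
  simp [pathCost]

theorem pathCost_singleton (w : Q → Q → ℝ) (a : Q) : pathCost w [a] = 0 := by
  simp [pathCost]

theorem pathCost_append_append (w : Q → Q → ℝ) (l : List Q) (a b : Q) :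
    pathCost w (l ++ [a] ++ [b]) = pathCost w (l ++ [a]) + w a b := by
  induction l with
  | nil => simp [pathCost]
  | cons x l ih =>
    cases l with
    | nil => simp [pathCost]
    | cons y l =>
      simp only [List.cons_append, pathCost_cons_cons] at ih ⊢
      rw [ih]; ring

theorem pathCost_nonneg (hw : ∀ a b, 0 ≤ w a b) (l : List Q) : 0 ≤ pathCost w l := by
  induction l with
  | nil => simp [pathCost]
  | cons x l ih =>
    cases l with
    | nil => simp [pathCost]
    | cons y l => rw [pathCost_cons_cons]; exact add_nonneg (hw _ _) ih

end Paths

/-! ### Tree paths -/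

section TreePaths

variable {Q : Type} {r : Q → Q → Prop} {w : Q → Q → ℝ} {root : Q} {t : Tree Q}

/-- `l` is the path from `root` to `q` along the parents of `t`, and it uses edges of `r` only. -/
inductive Tree.PathTo (t : Tree Q) (r : Q → Q → Prop) (root : Q) : Q → List Q → Prop
  | root : root ∈ t.nodes → t.parent root = none → PathTo t r root root [root]
  | step {p q : Q} {l : List Q} : q ∈ t.nodes → t.parent q = some p → r p q →
      PathTo t r root p l → PathTo t r root q (l ++ [q])

namespace Tree.PathTo

theorem mem_nodes {q : Q} {l : List Q} (h : t.PathTo r root q l) : q ∈ t.nodes := by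
  cases h <;> assumption

theorem exists_eq_append {q : Q} {l : List Q} (h : t.PathTo r root q l) :
    ∃ l₀, l = l₀ ++ [q] := by
  cases h with
  | root => exact ⟨[], rfl⟩
  | step => exact ⟨_, rfl⟩

theorem unique {q : Q} {l l' : List Q} (h : t.PathTo r root q l) (h' : t.PathTo r root q l') :
    l = l' := by
  induction h generalizing l' with
  | root _ h0 =>
    cases h' with
    | root => rfl
    | step _ h1 => simp [h0] at h1
  | step _ h1 _ _ ih =>
    cases h' with
    | root _ h0 => simp [h0] at h1
    | step _ h2 _ h3 =>
      rw [h1] at h2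
      cases h2
      rw [ih h3]

theorem exists_of_mem {q a : Q} {l : List Q} (h : t.PathTo r root q l) (ha : a ∈ l) :
    ∃ l', t.PathTo r root a l' ∧ l'.length ≤ l.length := by
  induction h with
  | root h1 h2 =>
    obtain rfl : a = root := by simpa using ha
    exact ⟨_, .root h1 h2, le_rfl⟩
  | step h1 h2 h3 h4 ih =>
    rcases List.mem_append.1 ha with h | h
    · obtain ⟨l', h5, h6⟩ := ih h
      exact ⟨l', h5, h6.trans (by simp)⟩
    · obtain rfl := List.mem_singleton.1 h
      exact ⟨_, .step h1 h2 h3 h4, le_rfl⟩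

/-- A second occurrence of the endpoint would yield a strictly shorter tree path to it, against
uniqueness. -/
theorem nodup {q : Q} {l : List Q} (h : t.PathTo r root q l) : l.Nodup := by
  induction h with
  | root => simp
  | step h1 h2 h3 h4 ih =>
    refine List.nodup_append.2 ⟨ih, by simp, ?_⟩
    rintro a ha b hb rfl
    obtain rfl := List.mem_singleton.1 hb
    obtain ⟨l', h5, h6⟩ := h4.exists_of_mem ha
    rw [h5.unique (.step h1 h2 h3 h4)] at h6
    simp at h6

theorem length_le_card {q : Q} {l : List Q} (h : t.PathTo r root q l) :
    l.length ≤ t.nodes.card := by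
  classical
  rw [← List.toFinset_card_of_nodup h.nodup]
  refine Finset.card_le_card fun a ha => ?_
  obtain ⟨l', h', -⟩ := h.exists_of_mem (List.mem_toFinset.1 ha)
  exact h'.mem_nodes

theorem tracePath_eq {q : Q} {l : List Q} (h : t.PathTo r root q l) :
    ∀ n, l.length ≤ n + 1 → tracePath t.parent n q = l := by
  induction h with
  | root h1 h2 =>
    intro n _
    cases n <;> simp [tracePath, h2]
  | step h1 h2 h3 h4 ih =>
    intro n hn
    obtain ⟨l₀, rfl⟩ := h4.exists_eq_append
    cases n with
    | zero => simp at hn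
    | succ n =>
      simp only [tracePath, h2]
      rw [ih n (by simpa using hn)]

/-- A tree path has no repetitions, so the number of nodes is enough fuel for `tracePath`. This lets
the inductive predicate replace the recursive search everywhere below. -/
theorem findPath_eq {q : Q} {l : List Q} (h : t.PathTo r root q l) : t.findPath q = l :=
  h.tracePath_eq _ (h.length_le_card.trans (Nat.le_succ _))

theorem cost_eq {q : Q} {l : List Q} (h : t.PathTo r root q l) : t.cost w q = pathCost w l := by
  rw [Tree.cost, h.findPath_eq]

theorem pathCost_step {p : Q} {l : List Q} (h : t.PathTo r root p l) (q : Q) :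
    pathCost w (l ++ [q]) = pathCost w l + w p q := by
  obtain ⟨l₀, rfl⟩ := h.exists_eq_append
  exact pathCost_append_append _ _ _ _

theorem isChain {q : Q} {l : List Q} (h : t.PathTo r root q l) : l.IsChain r := by
  induction h with
  | root => simp
  | step h1 h2 h3 h4 ih =>
    obtain ⟨l₀, rfl⟩ := h4.exists_eq_append
    refine List.isChain_append.2 ⟨ih, by simp, ?_⟩
    simpa using h3

theorem head?_eq {q : Q} {l : List Q} (h : t.PathTo r root q l) : l.head? = some root := by
  induction h with
  | root => simp
  | step h1 h2 h3 h4 ih => simp [List.head?_append, ih]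

theorem getLast?_eq {q : Q} {l : List Q} (h : t.PathTo r root q l) : l.getLast? = some q := by
  obtain ⟨l₀, rfl⟩ := h.exists_eq_append
  simp

end Tree.PathTo

/-- The invariant of the tree construction: every node is reached from the root through the tree,
and the successors of the root cost at most the edge from the root. -/
structure Tree.Inv (r : Q → Q → Prop) (w : Q → Q → ℝ) (root : Q) (t : Tree Q) : Prop where
  root_path : t.PathTo r root root [root]
  paths : ∀ q ∈ t.nodes, ∃ l, t.PathTo r root q l
  root_edge : ∀ v ∈ t.nodes, r root v → t.cost w v ≤ w root v

/-- `t` has the nodes of `s`, at no larger cost. -/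
def Tree.Le (w : Q → Q → ℝ) (s t : Tree Q) : Prop :=
  s.nodes ⊆ t.nodes ∧ ∀ q ∈ s.nodes, t.cost w q ≤ s.cost w q

/-- Every state reachable from the root is a node, at the least possible cost. -/
def Tree.IsOptimal (r : Q → Q → Prop) (w : Q → Q → ℝ) (root : Q) (t : Tree Q) : Prop :=
  ∀ (l : List Q) (v : Q), (root :: l).IsChain r → (root :: l).getLast? = some v →
    v ∈ t.nodes ∧ t.cost w v ≤ pathCost w (root :: l)

theorem Tree.Le.refl (t : Tree Q) : t.Le w t := ⟨Finset.Subset.refl _, fun _ _ => le_rfl⟩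

theorem Tree.Le.trans {s t u : Tree Q} (h : s.Le w t) (h' : t.Le w u) : s.Le w u :=
  ⟨h.1.trans h'.1, fun q hq => (h'.2 q (h.1 hq)).trans (h.2 q hq)⟩

theorem Tree.IsOptimal.mono {s t : Tree Q} (h : s.IsOptimal r w root) (hst : s.Le w t) :
    t.IsOptimal r w root := fun l v h1 h2 =>
  ⟨hst.1 (h l v h1 h2).1, (hst.2 _ (h l v h1 h2).1).trans (h l v h1 h2).2⟩

theorem Tree.Inv.cost_root (h : t.Inv r w root) : t.cost w root = 0 := by
  rw [h.root_path.cost_eq, pathCost_singleton]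

theorem Tree.inv_init (hw : ∀ a b, 0 ≤ w a b) (root : Q) : (Tree.init root).Inv r w root := by
  have h : (Tree.init root).PathTo r root root [root] := .root (by simp [Tree.init]) rfl
  have hq : ∀ q ∈ (Tree.init root).nodes, q = root := by simp [Tree.init]
  refine ⟨h, fun q hq' => ⟨[root], by rw [hq q hq']; exact h⟩, fun q hq' _ => ?_⟩
  rw [hq q hq', h.cost_eq, pathCost_singleton]
  exact hw _ _

/-- Bellman's condition implies optimality. -/
theorem Tree.Inv.isOptimal (h : t.Inv r w root)
    (hloc : ∀ u ∈ t.nodes, ∀ v, r u v → v ∈ t.nodes ∧ t.cost w v ≤ t.cost w u + w u v) :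
    t.IsOptimal r w root := by
  have key : ∀ (l : List Q) (u v : Q), u ∈ t.nodes → (u :: l).IsChain r →
      (u :: l).getLast? = some v →
      v ∈ t.nodes ∧ t.cost w v ≤ t.cost w u + pathCost w (u :: l) := by
    intro l
    induction l with
    | nil =>
      intro u v hu _ hv
      obtain rfl : u = v := by simpa using hv
      exact ⟨hu, by simp [pathCost]⟩
    | cons a l ih =>
      intro u v hu hc hv
      rw [List.isChain_cons_cons] at hc
      obtain ⟨ha, hca⟩ := hloc u hu a hc.1
      obtain ⟨h1, h2⟩ := ih a v ha hc.2 (by simpa using hv)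
      refine ⟨h1, ?_⟩
      rw [pathCost_cons_cons]
      linarith
  intro l v hc hv
  obtain ⟨h1, h2⟩ := key l root v h.root_path.mem_nodes hc hv
  exact ⟨h1, by rwa [h.cost_root, zero_add] at h2⟩

end TreePaths

/-! ### Extending and rewiring -/

section TreeOperations

variable {Q : Type} {r : Q → Q → Prop} {w : Q → Q → ℝ} {root : Q} {t : Tree Q}

-- Strictness of the decrease is what prevents cycles, even with zero weights: costs do not decrease
-- along a tree path, so `p`, being more expensive than `q`, is not on the path to `q`.
open scoped Classical in
theorem Tree.Inv.reparent (hw : ∀ a b, 0 ≤ w a b) (h : t.Inv r w root) {p q : Q}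
    (hp : p ∈ t.nodes) (hq : q ∈ t.nodes) (hr : r q p) (hlt : t.cost w q + w q p < t.cost w p) :
    let t' : Tree Q := ⟨t.nodes, Function.update t.parent p (some q)⟩
    t'.Inv r w root ∧ t.Le w t' ∧ t'.cost w p ≤ t.cost w q + w q p := by
  intro t'
  -- Paths cheaper than the cost of `p` avoid `p`, the only state whose parent changes. This covers
  -- the path to `q` and, as the root has cost zero, the trivial path.
  have hkeep : ∀ a l, t.PathTo r root a l → pathCost w l < t.cost w p →
      t'.PathTo r root a l := by
    intro a l hl
    induction hl with
    | root h1 h2 =>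
      intro hlt'
      have hne : root ≠ p := by
        rintro rfl
        rw [(Tree.PathTo.root h1 h2 : t.PathTo r root root [root]).cost_eq] at hlt'
        exact hlt'.false
      exact .root h1 (by simpa [t', Function.update_of_ne hne] using h2)
    | @step b a l h1 h2 h3 h4 ih =>
      intro hlt'
      have hne : a ≠ p := by
        rintro rfl
        rw [(Tree.PathTo.step h1 h2 h3 h4).cost_eq] at hlt'
        exact hlt'.false
      rw [h4.pathCost_step] at hlt'
      exact .step h1 (by simpa [t', Function.update_of_ne hne] using h2) h3
        (ih (by linarith [hw b a]))
  obtain ⟨lq, hlq⟩ := h.paths q hq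
  have hcq : pathCost w lq = t.cost w q := hlq.cost_eq.symm
  have hlq' : t'.PathTo r root q lq := hkeep q lq hlq (by linarith [hw q p])
  have hpp : t'.PathTo r root p (lq ++ [p]) := .step hp (by simp [t']) hr hlq'
  have hpc : pathCost w (lq ++ [p]) = t.cost w q + w q p := by rw [hlq.pathCost_step, hcq]
  have hroot : t'.PathTo r root root [root] := by
    refine hkeep _ _ h.root_path ?_
    rw [pathCost_singleton]
    exact lt_of_le_of_lt (add_nonneg (pathCost_nonneg hw _) (hw q p)) hlt
  -- A path through `p` has its initial segment up to `p` replaced by the cheaper path through `q`.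
  have hall : ∀ a l, t.PathTo r root a l →
      ∃ l', t'.PathTo r root a l' ∧ pathCost w l' ≤ pathCost w l := by
    intro a l hl
    induction hl with
    | root => exact ⟨_, hroot, le_rfl⟩
    | @step b a l h1 h2 h3 h4 ih =>
      by_cases hne : a = p
      · subst hne
        refine ⟨_, hpp, ?_⟩
        rw [hpc, ← (Tree.PathTo.step h1 h2 h3 h4).cost_eq]
        exact hlt.le
      · obtain ⟨l', h5, h6⟩ := ih
        refine ⟨_, .step h1 (by simpa [t', Function.update_of_ne hne] using h2) h3 h5, ?_⟩
        rw [h4.pathCost_step, h5.pathCost_step]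
        linarith
  have hle : t.Le w t' := by
    refine ⟨Finset.Subset.refl _, fun a ha => ?_⟩
    obtain ⟨l, hl⟩ := h.paths a ha
    obtain ⟨l', h1, h2⟩ := hall a l hl
    rwa [h1.cost_eq, hl.cost_eq]
  refine ⟨⟨hroot, fun a ha => ?_, fun v hv hrv => (hle.2 v hv).trans (h.root_edge v hv hrv)⟩,
    hle, ?_⟩
  · obtain ⟨l, hl⟩ := h.paths a ha
    obtain ⟨l', h1, -⟩ := hall a l hl
    exact ⟨l', h1⟩
  · rw [hpp.cost_eq, hpc]

theorem Tree.Inv.rewire (hw : ∀ a b, 0 ≤ w a b) (h : t.Inv r w root) {q : Q} (hq : q ∈ t.nodes) :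
    (t.rewire r w q).Inv r w root ∧ t.Le w (t.rewire r w q) ∧
      ∀ p ∈ t.nodes, r q p → (t.rewire r w q).cost w p ≤ t.cost w q + w q p := by
  classical
  -- The fold tests against current costs; as these never increase, the bound with the initial cost
  -- of `q` survives each later step.
  have key : ∀ (L : List Q) (t : Tree Q), t.Inv r w root → q ∈ t.nodes →
      (∀ p ∈ L, p ∈ t.nodes ∧ r q p) →
      let t' := L.foldl (fun s p =>
        if s.cost w q + w q p < s.cost w p
        then ⟨s.nodes, Function.update s.parent p (some q)⟩ else s) t
      t'.Inv r w root ∧ t.Le w t' ∧ ∀ p ∈ L, t'.cost w p ≤ t.cost w q + w q p := by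
    intro L
    induction L with
    | nil => intro t h _ _; exact ⟨h, Tree.Le.refl t, by simp⟩
    | cons a L ih =>
      intro t h hq hL
      have ha := hL a (by simp)
      have hstep : ∃ s : Tree Q, s = (if t.cost w q + w q a < t.cost w a
          then ⟨t.nodes, Function.update t.parent a (some q)⟩ else t) ∧
          s.Inv r w root ∧ t.Le w s ∧ s.cost w a ≤ t.cost w q + w q a := by
        refine ⟨_, rfl, ?_⟩
        split_ifs with hlt
        · exact h.reparent hw ha.1 hq ha.2 hlt
        · exact ⟨h, Tree.Le.refl t, not_lt.1 hlt⟩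
      obtain ⟨s, hs, h1, h2, h3⟩ := hstep
      obtain ⟨h4, h5, h6⟩ := ih s h1 (h2.1 hq)
        fun p hp => ⟨h2.1 (hL p (by simp [hp])).1, (hL p (by simp [hp])).2⟩
      simp only [List.foldl_cons, ← hs]
      refine ⟨h4, h2.trans h5, fun p hp => ?_⟩
      rcases List.mem_cons.1 hp with rfl | hp
      · exact (h5.2 p (h2.1 ha.1)).trans h3
      · have := h6 p hp
        have := h2.2 q hq
        linarith
  obtain ⟨h1, h2, h3⟩ := key (t.nodes.filter fun p => r q p).toList t h hq
    (fun p hp => by simpa using hp)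
  exact ⟨h1, h2, fun p hp hr => h3 p (by simp [hp, hr])⟩

/-- Existing paths consist of nodes, so setting the parent of the fresh state `q` leaves them and
their costs unchanged. -/
theorem Tree.Inv.extend (h : t.Inv r w root) {q : Q} (hq : q ∉ t.nodes) :
    (t.extend r w q).Inv r w root ∧ t.Le w (t.extend r w q) ∧
      ∀ p ∈ t.nodes, r p q → q ∈ (t.extend r w q).nodes := by
  classical
  by_cases hne : (t.nodes.filter fun p => r p q).Nonempty
  swap
  · have : t.extend r w q = t := by simp only [Tree.extend]; rw [dif_neg hne]
    rw [this]
    refine ⟨h, Tree.Le.refl t, fun p hp hr => ?_⟩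
    exact absurd ⟨p, by simp [hp, hr]⟩ hne
  obtain ⟨p, hp, hmin, heq⟩ : ∃ p ∈ t.nodes.filter (fun p => r p q),
      (∀ p' ∈ t.nodes.filter (fun p => r p q), t.cost w p + w p q ≤ t.cost w p' + w p' q) ∧
      t.extend r w q = ⟨insert q t.nodes, Function.update t.parent q (some p)⟩ := by
    have hc := (Finset.exists_min_image _ (fun p => t.cost w p + w p q) hne).choose_spec
    refine ⟨_, hc.1, hc.2, ?_⟩
    simp only [Tree.extend]
    rw [dif_pos hne]
  rw [heq]
  set t' : Tree Q := ⟨insert q t.nodes, Function.update t.parent q (some p)⟩ with ht'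
  have hkeep : ∀ a l, t.PathTo r root a l → t'.PathTo r root a l := by
    intro a l hl
    induction hl with
    | root h1 h2 =>
      have hne : root ≠ q := by rintro rfl; exact hq h1
      exact .root (by simp [ht', h1]) (by simpa [ht', Function.update_of_ne hne] using h2)
    | @step b a l h1 h2 h3 h4 ih =>
      have hne : a ≠ q := by rintro rfl; exact hq h1
      exact .step (by simp [ht', h1]) (by simpa [ht', Function.update_of_ne hne] using h2) h3 ih
  obtain ⟨hpm, hpr⟩ := Finset.mem_filter.1 hp
  obtain ⟨lp, hlp⟩ := h.paths p hpm
  have hqp : t'.PathTo r root q (lp ++ [q]) :=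
    .step (by simp [ht']) (by simp [ht']) hpr (hkeep _ _ hlp)
  have hle : t.Le w t' := by
    refine ⟨by simp [ht'], fun a ha => ?_⟩
    obtain ⟨l, hl⟩ := h.paths a ha
    rw [hl.cost_eq, (hkeep _ _ hl).cost_eq]
  refine ⟨⟨hkeep _ _ h.root_path, fun a ha => ?_, fun v hv hrv => ?_⟩, hle, fun _ _ _ => by
    simp [ht']⟩
  · rcases Finset.mem_insert.1 ha with rfl | ha
    · exact ⟨_, hqp⟩
    · obtain ⟨l, hl⟩ := h.paths a ha
      exact ⟨l, hkeep _ _ hl⟩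
  · rcases Finset.mem_insert.1 hv with rfl | hv
    -- The root itself competes for being the parent of the new node, which gives `root_edge`.
    · have := hmin root (by simp [h.root_path.mem_nodes, hrv])
      rw [hqp.cost_eq, hlp.pathCost_step, ← hlp.cost_eq]
      rwa [h.cost_root, zero_add] at this
    · exact (hle.2 v hv).trans (h.root_edge v hv hrv)

end TreeOperations

/-! ### One tree update and strict improvement -/

section Update

theorem pbaWeight_nonneg {N W : ℕ} {QB : Type} (S : Fin N → WTS W) (p p' : QP N W QB) :
    0 ≤ pbaWeight S p p' := by
  unfold pbaWeight ptsWeight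
  positivity

variable {N W : ℕ} {QB : Type} [Fintype QB] {S : Fin N → WTS W} {B : NBA (AP N W) QB}
  {root : QP N W QB} {t : Tree (QP N W QB)}

theorem Tree.Inv.update (h : t.Inv (pbaTrans S B) (pbaWeight S) root) (x : QPTS N W) :
    (update S B t x).Inv (pbaTrans S B) (pbaWeight S) root ∧
      t.Le (pbaWeight S) (update S B t x) ∧
      (∀ b, ∀ u ∈ t.nodes, pbaTrans S B u (x, b) → (x, b) ∈ (update S B t x).nodes) ∧
      ∀ b, (x, b) ∈ t.nodes → ∀ v ∈ t.nodes, pbaTrans S B (x, b) v →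
        (update S B t x).cost (pbaWeight S) v ≤
          t.cost (pbaWeight S) (x, b) + pbaWeight S (x, b) v := by
  classical
  have hw := pbaWeight_nonneg (QB := QB) S
  have key : ∀ (L : List QB) (t : Tree (QP N W QB)), t.Inv (pbaTrans S B) (pbaWeight S) root →
      let t' := L.foldl (fun s b =>
        let s' := if (x, b) ∈ s.nodes then s
          else s.extend (pbaTrans S B) (pbaWeight S) (x, b)
        if (x, b) ∈ s'.nodes then s'.rewire (pbaTrans S B) (pbaWeight S) (x, b) else s') t
      t'.Inv (pbaTrans S B) (pbaWeight S) root ∧ t.Le (pbaWeight S) t' ∧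
      (∀ b ∈ L, ∀ u ∈ t.nodes, pbaTrans S B u (x, b) → (x, b) ∈ t'.nodes) ∧
      ∀ b ∈ L, (x, b) ∈ t.nodes → ∀ v ∈ t.nodes, pbaTrans S B (x, b) v →
        t'.cost (pbaWeight S) v ≤ t.cost (pbaWeight S) (x, b) + pbaWeight S (x, b) v := by
    intro L
    induction L with
    | nil => intro t h; exact ⟨h, Tree.Le.refl t, by simp, by simp⟩
    | cons b L ih =>
      intro t h
      obtain ⟨s', hs', h1, h2, h3⟩ : ∃ s', s' = (if (x, b) ∈ t.nodes then t
          else t.extend (pbaTrans S B) (pbaWeight S) (x, b)) ∧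
          s'.Inv (pbaTrans S B) (pbaWeight S) root ∧ t.Le (pbaWeight S) s' ∧
          ∀ u ∈ t.nodes, pbaTrans S B u (x, b) → (x, b) ∈ s'.nodes := by
        refine ⟨_, rfl, ?_⟩
        split_ifs with hb
        · exact ⟨h, Tree.Le.refl t, fun _ _ _ => hb⟩
        · exact h.extend hb
      obtain ⟨s, hs, h4, h5, h6⟩ : ∃ s, s = (if (x, b) ∈ s'.nodes
          then s'.rewire (pbaTrans S B) (pbaWeight S) (x, b) else s') ∧
          s.Inv (pbaTrans S B) (pbaWeight S) root ∧ s'.Le (pbaWeight S) s ∧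
          ((x, b) ∈ s'.nodes → ∀ v ∈ s'.nodes, pbaTrans S B (x, b) v →
            s.cost (pbaWeight S) v ≤
              s'.cost (pbaWeight S) (x, b) + pbaWeight S (x, b) v) := by
        refine ⟨_, rfl, ?_⟩
        split_ifs with hb
        · obtain ⟨h4, h5, h6⟩ := h1.rewire hw hb
          exact ⟨h4, h5, fun _ => h6⟩
        · exact ⟨h1, Tree.Le.refl s', fun hb' => absurd hb' hb⟩
      obtain ⟨h7, h8, h9, h10⟩ := ih s h4
      have hts := h2.trans h5
      simp only [List.foldl_cons, ← hs', ← hs]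
      refine ⟨h7, hts.trans h8, fun b' hb' u hu hr => ?_, fun b' hb' hm v hv hr => ?_⟩
      · rcases List.mem_cons.1 hb' with rfl | hb'
        · exact h8.1 (h5.1 (h3 u hu hr))
        · exact h9 b' hb' u (hts.1 hu) hr
      · rcases List.mem_cons.1 hb' with rfl | hb'
        · have e1 := h6 (h2.1 hm) v (h2.1 hv) hr
          have e2 := h2.2 _ hm
          have e3 := h8.2 v (hts.1 hv)
          linarith
        · have e1 := h10 b' hb' (hts.1 hm) v (hts.1 hv) hr
          have e2 := hts.2 _ hm
          linarith
  obtain ⟨h1, h2, h3, h4⟩ := key (Finset.univ : Finset QB).toList t h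
  exact ⟨h1, h2, fun b => h3 b (by simp), fun b => h4 b (by simp)⟩

/-- A tree that is not optimal is improved by some sample that can be drawn. -/
theorem Tree.Inv.exists_improvement (h : t.Inv (pbaTrans S B) (pbaWeight S) root)
    (hno : ¬ t.IsOptimal (pbaTrans S B) (pbaWeight S) root) :
    ∃ u ∈ t.nodes, ∃ v, pbaTrans S B u v ∧ ¬ (Stylus.update S B t v.1).Le (pbaWeight S) t := by
  have : ∃ u ∈ t.nodes, ∃ v, pbaTrans S B u v ∧
      (v ∈ t.nodes → t.cost (pbaWeight S) u + pbaWeight S u v < t.cost (pbaWeight S) v) := by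
    by_contra! hcon
    exact hno (h.isOptimal fun u hu v hr => hcon u hu v hr)
  obtain ⟨u, hu, v, hr, hv⟩ := this
  by_cases hvm : v ∈ t.nodes
  swap
  · exact ⟨u, hu, v, hr, fun hle => hvm (hle.1 ((h.update v.1).2.2.1 v.2 u hu hr))⟩
  obtain ⟨l, hl⟩ := h.paths u hu
  cases hl with
  -- The root may have no predecessor in the tree, so its team state need not be available as a
  -- sample; `root_edge` rules this case out.
  | root =>
    have := hv hvm
    rw [h.cost_root, zero_add] at this
    exact absurd (h.root_edge v hvm hr) this.not_ge
  | @step p _ l h1 h2 h3 h4 =>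
    -- The sample is the team part of `u`, drawn from its tree parent `p`, so that `u` is rewired
    -- again.
    refine ⟨p, h4.mem_nodes, u, h3, fun hle => ?_⟩
    obtain ⟨-, e1, -, e2⟩ := h.update u.1
    have e3 := e2 u.2 hu v hvm hr
    have e4 := hle.2 v (e1.1 hvm)
    have := hv hvm
    simp only [Prod.mk.eta] at e3
    linarith

end Update

/-! ### Absorption of monotone random sequences -/

section Runs

variable {Ω E : Type*} [MeasurableSpace Ω] {ℙ : Measure Ω} {x₀ : E} {κ : ℕ → E → PMF E}
  {X : ℕ → Ω → E}

/-- The one-step transition law, without the history. -/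
theorem IsRun.markov [Finite E] (h : IsRun ℙ x₀ κ X) (n : ℕ) (x y : E) :
    ℙ {ω | X n ω = x ∧ X (n + 1) ω = y} = ℙ {ω | X n ω = x} * κ n x y := by
  classical
  have := Fintype.ofFinite E
  let H : Ω → (Fin (n + 1) → E) := fun ω k => X k ω
  -- The law is given for complete histories; the Markov property results from summing over the
  -- finitely many histories that end in `x`, each continued by `y`.
  let ext : (Fin (n + 1) → E) → E → ℕ → E := fun f y k => if hk : k < n + 1 then f ⟨k, hk⟩ else y
  have hH : ∀ f : Fin (n + 1) → E, H ⁻¹' {f} = {ω | ∀ k ≤ n, X k ω = ext f y k} := by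
    intro f
    ext ω
    simp only [Set.mem_preimage, Set.mem_singleton_iff, Set.mem_ofPred_eq, H, ext, funext_iff]
    constructor
    · intro hf k hk
      rw [dif_pos (Nat.lt_succ_of_le hk)]
      exact hf ⟨k, _⟩
    · intro hf k
      have := hf k (Nat.lt_succ_iff.1 k.2)
      rwa [dif_pos k.2] at this
  have hHm : ∀ f : Fin (n + 1) → E, MeasurableSet (H ⁻¹' {f}) := by
    intro f
    have : H ⁻¹' {f} = ⋂ k : Fin (n + 1), {ω | X k ω = f k} := by
      ext ω; simp [H, funext_iff]
    rw [this]
    exact MeasurableSet.iInter fun k => h.measurable k (f k)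
  let s : Finset (Fin (n + 1) → E) := Finset.univ.filter fun f => f (Fin.last n) = x
  have hs : ∀ A : Set Ω, MeasurableSet A →
      ℙ {ω | X n ω = x ∧ ω ∈ A} = ∑ f ∈ s, ℙ (H ⁻¹' {f} ∩ A) := by
    intro A hA
    rw [← measure_biUnion_finset]
    · congr 1
      ext ω
      simp [s, H]
    · intro f _ g _ hfg
      refine Set.disjoint_left.2 fun ω hf hg => hfg ?_
      exact hf.1.symm.trans hg.1
    · exact fun f _ => (hHm f).inter hA
  have h1 := hs {ω | X (n + 1) ω = y} (h.measurable _ _)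
  have h2 := hs Set.univ MeasurableSet.univ
  simp only [Set.mem_ofPred_eq] at h1
  simp only [Set.mem_univ, and_true, Set.inter_univ] at h2
  rw [h1, h2, Finset.sum_mul]
  refine Finset.sum_congr rfl fun f hf => ?_
  have hlaw := h.law n (ext f y)
  have e1 : ext f y n = x := by
    have := (Finset.mem_filter.1 hf).2
    simp only [ext, Nat.lt_succ_self, dite_true]
    exact this
  have e2 : ext f y (n + 1) = y := by simp [ext]
  rw [e1, e2, ← hH] at hlaw
  rw [← hlaw]
  congr 1
  ext ω
  rw [hH]
  simp only [Set.mem_inter_iff, Set.mem_ofPred_eq]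
  constructor
  · rintro ⟨h3, h4⟩ k hk
    rcases Nat.lt_or_ge n k with h5 | h5
    · obtain rfl : k = n + 1 := by omega
      rw [h4, e2]
    · exact h3 k h5
  · intro h3
    exact ⟨fun k hk => h3 k (by omega), by rw [h3 _ le_rfl, e2]⟩

/-- Almost surely, every step has positive probability. -/
theorem IsRun.ae_step [Finite E] (h : IsRun ℙ x₀ κ X) :
    ∀ᵐ ω ∂ℙ, ∀ n, κ n (X n ω) (X (n + 1) ω) ≠ 0 := by
  rw [ae_all_iff]
  intro n
  have : {ω | ¬ κ n (X n ω) (X (n + 1) ω) ≠ 0} ⊆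
      ⋃ x, ⋃ y, ⋃ (_ : κ n x y = 0), {ω | X n ω = x ∧ X (n + 1) ω = y} := by
    intro ω hω
    simp only [Set.mem_ofPred_eq, not_not] at hω
    simp only [Set.mem_iUnion]
    exact ⟨X n ω, X (n + 1) ω, hω, rfl, rfl⟩
  refine measure_mono_null this ?_
  simp only [measure_iUnion_null_iff]
  intro x y hxy
  rw [h.markov, hxy, mul_zero]

/-- A random sequence in a finite preorder that never decreases, and that at infinitely many times
strictly increases with probability at least `c` unless it has reached the upper set `G`, reaches
`G` almost surely. -/
theorem IsRun.ae_eventually_mem [Finite E] [IsProbabilityMeasure ℙ] (h : IsRun ℙ x₀ κ X)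
    {le : E → E → Prop} (hrefl : ∀ x, le x x) (htrans : ∀ {x y z}, le x y → le y z → le x z)
    {I G : E → Prop} (hI₀ : I x₀) (hstep : ∀ n x y, I x → κ n x y ≠ 0 → I y ∧ le x y)
    (hG : ∀ x y, G x → le x y → G y) {c : ℝ≥0∞} (hc : c ≠ 0)
    (hprog : ∃ᶠ n in atTop, ∀ x, I x → ¬ G x → ∃ y, ¬ le y x ∧ c ≤ κ n x y) :
    ∀ᵐ ω ∂ℙ, ∀ᶠ n in atTop, I (X n ω) ∧ G (X n ω) := by
  classical
  have := Fintype.ofFinite E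
  have hpath : ∀ᵐ ω ∂ℙ, ∀ n, I (X n ω) ∧ ∀ m ≤ n, le (X m ω) (X n ω) := by
    filter_upwards [h.start, h.ae_step] with ω h0 hω n
    induction n with
    | zero =>
      refine ⟨by rwa [h0], fun m hm => ?_⟩
      obtain rfl := Nat.le_zero.1 hm
      exact hrefl _
    | succ n ih =>
      obtain ⟨h1, h2⟩ := hstep n _ _ ih.1 (hω n)
      refine ⟨h1, fun m hm => ?_⟩
      rcases Nat.lt_or_ge n m with h3 | h3
      · obtain rfl : m = n + 1 := by omega
        exact hrefl _
      · exact htrans (ih.2 m h3) h2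
  -- The size of the lower set turns a strict increase in the preorder into an increase by at least
  -- one. Its expectation `e` serves as a potential.
  let rank : E → ℕ := fun x => (Finset.univ.filter fun y => le y x).card
  have hrank : ∀ x y, le x y → rank x ≤ rank y := fun x y hxy =>
    Finset.card_le_card fun z hz => by
      simp only [Finset.mem_filter, Finset.mem_univ, true_and] at hz ⊢
      exact htrans hz hxy
  have hrank' : ∀ x y, le x y → ¬ le y x → rank x + 1 ≤ rank y := fun x y hxy hyx =>
    Finset.card_lt_card <| by
      refine Finset.ssubset_iff_subset_ne.2 ⟨fun z hz => ?_, fun he => hyx ?_⟩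
      · simp only [Finset.mem_filter, Finset.mem_univ, true_and] at hz ⊢
        exact htrans hz hxy
      · have : y ∈ Finset.univ.filter fun z => le z x := by
          rw [he]; simp [hrefl]
        simpa using this
  let a : ℕ → E → ℝ≥0∞ := fun n x => ℙ {ω | X n ω = x}
  have hsum1 : ∀ n x, ∑ y, κ n x y = 1 := fun n x => by
    rw [← tsum_fintype (L := .unconditional E)]; exact (κ n x).tsum_coe
  have hsum : ∀ n (A : Set E), ℙ {ω | X n ω ∈ A} = ∑ x, if x ∈ A then a n x else 0 := by
    intro n A
    rw [← Finset.sum_filter, ← measure_biUnion_finset]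
    · congr 1
      ext ω
      simp
    · intro x _ y _ hxy
      exact Set.disjoint_left.2 fun ω hx hy => hxy (hx.symm.trans hy)
    · exact fun x _ => h.measurable n x
  have htot : ∀ n, ∑ x, a n x = 1 := fun n => by
    have := hsum n Set.univ
    simpa using this.symm
  have hmarg : ∀ n y, a (n + 1) y = ∑ x, a n x * κ n x y := by
    intro n y
    have : {ω | X (n + 1) ω = y} = ⋃ x ∈ (Finset.univ : Finset E),
        {ω | X n ω = x ∧ X (n + 1) ω = y} := by ext; simp
    simp only [a]
    rw [this, measure_biUnion_finset]
    · exact Finset.sum_congr rfl fun x _ => h.markov n x y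
    · intro x _ z _ hxz
      exact Set.disjoint_left.2 fun ω hx hz => hxz (hx.1.symm.trans hz.1)
    · exact fun x _ => (h.measurable n x).inter (h.measurable (n + 1) y)
  have hinv : ∀ n x, a n x ≠ 0 → I x := by
    intro n x hx
    by_contra hIx
    refine hx (measure_mono_null (t := {ω | ¬ (I (X n ω))}) ?_ ?_)
    · rintro ω rfl; exact hIx
    · exact ae_iff.1 (hpath.mono fun ω hω => (hω n).1)
  let e : ℕ → ℝ≥0∞ := fun n => ∑ x, a n x * rank x
  let b : ℕ → ℝ≥0∞ := fun n => ℙ {ω | ¬ G (X n ω)}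
  have hexp : ∀ n, e (n + 1) = ∑ x, a n x * ∑ y, κ n x y * rank y := by
    intro n
    simp only [e, hmarg, Finset.sum_mul, Finset.mul_sum]
    rw [Finset.sum_comm]
    simp only [mul_assoc]
  have hge : ∀ n x, I x → (rank x : ℝ≥0∞) ≤ ∑ y, κ n x y * rank y := by
    intro n x hx
    calc (rank x : ℝ≥0∞) = ∑ y, κ n x y * rank x := by rw [← Finset.sum_mul, hsum1, one_mul]
      _ ≤ _ := Finset.sum_le_sum fun y _ => by
        by_cases h0 : κ n x y = 0
        · simp [h0]
        · gcongr
          exact hrank _ _ (hstep n x y hx h0).2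
  have hge' : ∀ n x y, I x → ¬ le y x → c ≤ κ n x y →
      (rank x : ℝ≥0∞) + c ≤ ∑ y, κ n x y * rank y := by
    intro n x y hx hyx hcy
    calc (rank x : ℝ≥0∞) + c ≤ ∑ z, κ n x z * (rank x + if z = y then 1 else 0) := by
          simp only [mul_add, Finset.sum_add_distrib, mul_ite, mul_one, mul_zero,
            Finset.sum_ite_eq', Finset.mem_univ, if_true]
          rw [← Finset.sum_mul, hsum1, one_mul]
          gcongr
      _ ≤ _ := Finset.sum_le_sum fun z _ => by
        by_cases h0 : κ n x z = 0
        · simp [h0]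
        · gcongr
          split_ifs with hz
          · subst hz
            exact_mod_cast hrank' _ _ (hstep n x z hx h0).2 hyx
          · rw [add_zero]
            exact_mod_cast hrank _ _ (hstep n x z hx h0).2
  have hmono : ∀ n, e n ≤ e (n + 1) := by
    intro n
    rw [hexp]
    refine Finset.sum_le_sum fun x _ => ?_
    by_cases h0 : a n x = 0
    · simp [h0]
    · gcongr
      exact hge n x (hinv n x h0)
  have hjump : ∀ n, (∀ x, I x → ¬ G x → ∃ y, ¬ le y x ∧ c ≤ κ n x y) →
      e n + c * b n ≤ e (n + 1) := by
    intro n hn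
    have hb : b n = ∑ x, if x ∈ {x | ¬ G x} then a n x else 0 := by
      convert hsum n {x | ¬ G x}
    rw [hexp, hb, Finset.mul_sum, ← Finset.sum_add_distrib]
    refine Finset.sum_le_sum fun x _ => ?_
    by_cases h0 : a n x = 0
    · simp [h0]
    have hx := hinv n x h0
    by_cases hGx : G x
    · simp only [Set.mem_ofPred_eq, hGx, not_true_eq_false, if_false, mul_zero, add_zero]
      gcongr
      exact hge n x hx
    · obtain ⟨y, h1, h2⟩ := hn x hx hGx
      simp only [Set.mem_ofPred_eq, hGx, not_false_eq_true, if_true]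
      rw [mul_comm c, ← mul_add]
      gcongr
      exact hge' n x y hx h1 h2
  have hebound : ∀ n, e n ≤ Fintype.card E := by
    intro n
    calc e n ≤ ∑ x, a n x * (Fintype.card E : ℝ≥0∞) := Finset.sum_le_sum fun x _ => by
          gcongr
          exact_mod_cast Finset.card_le_univ _
      _ = _ := by rw [← Finset.sum_mul, htot, one_mul]
  have hnull : ℙ {ω | ∀ n, ¬ G (X n ω)} = 0 := by
    set δ := ℙ {ω | ∀ n, ¬ G (X n ω)} with hδ
    have hbδ : ∀ n, δ ≤ b n := fun n => measure_mono fun ω hω => hω n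
    by_contra h0
    have hmono' : Monotone e := monotone_nat_of_le_succ hmono
    -- Each of the infinitely many good times adds at least `c * δ` to the potential, which
    -- contradicts its bound by the number of states unless `δ = 0`.
    have hgrow : ∀ k : ℕ, ∃ n, k * (c * δ) ≤ e n := by
      intro k
      induction k with
      | zero => exact ⟨0, by simp⟩
      | succ k ih =>
        obtain ⟨n, hn⟩ := ih
        obtain ⟨m, hm, hm'⟩ := (frequently_atTop.1 hprog) n
        refine ⟨m + 1, le_trans ?_ (hjump m hm')⟩
        push_cast
        rw [add_mul, one_mul]
        exact add_le_add (hn.trans (hmono' hm)) (by gcongr; exact hbδ m)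
    have hcδ : c * δ ≠ 0 := mul_ne_zero hc h0
    obtain ⟨k, hk⟩ := ENNReal.exists_nat_mul_gt hcδ (ENNReal.natCast_ne_top (Fintype.card E))
    obtain ⟨n, hn⟩ := hgrow k
    exact absurd (hn.trans (hebound n)) hk.not_ge
  have hhit : ∀ᵐ ω ∂ℙ, ∃ n, G (X n ω) := by
    rw [ae_iff]
    simpa using hnull
  filter_upwards [hpath, hhit] with ω hω ⟨n, hn⟩
  filter_upwards [eventually_ge_atTop n] with m hm
  exact ⟨(hω m).1, hG _ _ hn ((hω m).2 n hm)⟩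

end Runs

/-! ### Lower bounds on the sampling probabilities -/

section Sampling

theorem le_biased {α : Type} [Fintype α] {p : unitInterval} {ε : ℝ}
    (hp : (p : ℝ) ∈ Set.Icc ε (1 - ε)) (A T : Finset α) (hT : T.Nonempty) {x : α} (hx : x ∈ T) :
    ENNReal.ofReal ε / Fintype.card α ≤ biased p A T hT x := by
  classical
  have hcard : ∀ U : Finset α, (U.card : ℝ≥0∞) ≤ Fintype.card α := fun U => by
    exact_mod_cast Finset.card_le_univ U
  change _ ≤ biasedDensity p A T x
  unfold biasedDensity
  split_ifs with h1 h2 h3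
  · exact ENNReal.div_le_div (ENNReal.ofReal_le_ofReal hp.1) (hcard _)
  · exact ENNReal.div_le_div (ENNReal.ofReal_le_ofReal (by linarith [hp.2])) (hcard _)
  · simp only [Finset.mem_inter, Finset.mem_sdiff, hx, true_and] at h2 h3
    tauto
  · refine ENNReal.div_le_div ?_ (hcard _)
    rw [ENNReal.ofReal_le_one]
    exact hp.1.trans p.2.2

theorem PMF.le_bind {α γ : Type*} {p : PMF α} {f : α → PMF γ} {y : γ} {c : ℝ≥0∞}
    (h : ∀ a ∈ p.support, c ≤ f a y) : c ≤ p.bind f y := by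
  rw [PMF.bind_apply]
  calc c = ∑' a, p a * c := by rw [ENNReal.tsum_mul_right, p.tsum_coe, one_mul]
    _ ≤ _ := ENNReal.tsum_le_tsum fun a => by
      by_cases h0 : p a = 0
      · simp [h0]
      · gcongr
        exact h a ((PMF.mem_support_iff _ _).2 h0)

theorem PMF.mul_le_bind {α γ : Type*} (p : PMF α) (f : α → PMF γ) (a : α) (y : γ) :
    p a * f a y ≤ p.bind f y := by
  rw [PMF.bind_apply]
  exact ENNReal.le_tsum (f := fun a => p a * f a y) a

theorem PMF.le_map {α γ : Type*} (p : PMF α) (f : α → γ) (a : α) : p a ≤ p.map f (f a) := by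
  classical
  rw [PMF.map_apply]
  refine le_trans ?_ (ENNReal.le_tsum a)
  rw [if_pos rfl]

variable {N W : ℕ} {QB : Type} [Fintype QB] (S : Fin N → WTS W) (B : NBA (AP N W) QB)

theorem le_drawNew {pNew : Fin N → unitInterval} {ε : ℝ}
    (hp : ∀ i, (pNew i : ℝ) ∈ Set.Icc ε (1 - ε)) {q x : QPTS N W}
    (dest : Fin N → Option (Fin W)) (hx : ptsTrans S q x) :
    (ENNReal.ofReal ε / Fintype.card (Fin W)) ^ N ≤ drawNew S pNew q dest (some x) := by
  classical
  have hmem : ∀ i, x i ∈ reachWTS S i (q i) := fun i => by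
    simpa [reachWTS] using hx i
  unfold drawNew
  rw [dif_pos fun i => ⟨x i, hmem i⟩]
  refine le_trans ?_ (PMF.le_map _ _ _)
  change _ ≤ ∏ i : Fin N, _
  calc (ENNReal.ofReal ε / Fintype.card (Fin W)) ^ N
      = ∏ _i : Fin N, ENNReal.ofReal ε / (Fintype.card (Fin W) : ℝ≥0∞) := by simp
    _ ≤ _ := Finset.prod_le_prod' fun i _ => le_biased (hp i) _ _ _ (hmem i)

/-- A lower bound on the probability of every sample that can be reached from the tree. -/
def sampleBound (N W : ℕ) (QB : Type) [Fintype QB] (ε : ℝ) : ℝ≥0∞ :=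
  ENNReal.ofReal ε / Fintype.card (QP N W QB) * (ENNReal.ofReal ε / Fintype.card (Fin W)) ^ N

theorem sampleBound_ne_zero (N W : ℕ) (QB : Type) [Fintype QB] {ε : ℝ} (hε : 0 < ε) :
    sampleBound N W QB ε ≠ 0 := by
  -- Empty types do no harm: division by zero in `ℝ≥0∞` gives `⊤` here, which is nonzero.
  refine mul_ne_zero ?_ (pow_ne_zero _ ?_) <;>
  · refine (ENNReal.div_pos ?_ (ENNReal.natCast_ne_top _)).ne'
    simpa using hε

/-- The automaton states drawn in between affect only the destinations, and the bound of
`le_drawNew` holds for all destinations. So only the draw of the node and the moves of the robots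
cost probability. -/
theorem le_sample {pRand : unitInterval} {pNew : QP N W QB → Fin N → unitInterval} {ε : ℝ}
    (hr : (pRand : ℝ) ∈ Set.Icc ε (1 - ε)) (hp : ∀ p i, (pNew p i : ℝ) ∈ Set.Icc ε (1 - ε))
    {skip : Prop} (hskip : ¬ skip) (g : QB) (root? : Option (QP N W QB)) {t : Tree (QP N W QB)}
    {u v : QP N W QB} (hu : u ∈ t.nodes) (huv : pbaTrans S B u v) :
    sampleBound N W QB ε ≤ sample S B g root? pRand pNew skip t (some v.1) := by
  classical
  unfold sample
  rw [dif_pos ⟨u, hu⟩]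
  refine le_trans ?_ (PMF.mul_le_bind _ _ u _)
  refine mul_le_mul' (le_biased hr _ _ _ hu) ?_
  rw [if_pos ⟨v.2, by simpa [reachB] using huv.2⟩]
  split_ifs with hM
  · refine PMF.le_bind fun b hb => ?_
    have hD : (decr B g b).Nonempty := by
      rw [PMF.mem_support_uniformOfFinset_iff] at hb
      exact (Finset.mem_filter.1 hb).2
    rw [dif_pos hD]
    exact PMF.le_bind fun b' _ => le_drawNew S (hp u) _ huv.1
  · exact le_drawNew S (hp u) _ huv.1

theorem le_treeStep {target : ℕ → Tree (QP N W QB) → QB} {root? : Option (QP N W QB)}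
    {θ : SamplingParams N W QB} {ε : ℝ} (hθ : θ.Admissible ε) {n : ℕ} {t : Tree (QP N W QB)}
    (hn : ¬ θ.skip n t) {u v : QP N W QB} (hu : u ∈ t.nodes) (huv : pbaTrans S B u v) :
    sampleBound N W QB ε ≤ treeStep S B target root? θ n t (update S B t v.1) :=
  (le_sample S B (hθ.1 n t) (hθ.2.1 n t) hn (target n t) root? hu huv).trans
    (PMF.le_map _ (fun o : Option (QPTS N W) =>
      match o with
      | some x => update S B t x
      | none => t) (some v.1))

theorem eq_or_eq_update_of_treeStep_ne_zero {target : ℕ → Tree (QP N W QB) → QB}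
    {root? : Option (QP N W QB)} {θ : SamplingParams N W QB} {n : ℕ} {t t' : Tree (QP N W QB)}
    (h : treeStep S B target root? θ n t t' ≠ 0) : t' = t ∨ ∃ x, t' = update S B t x := by
  rw [← PMF.mem_support_iff, treeStep, PMF.support_map] at h
  obtain ⟨o, -, rfl⟩ := h
  cases o with
  | none => exact .inl rfl
  | some x => exact .inr ⟨x, rfl⟩

theorem finite_tree (Q : Type) [Finite Q] : Finite (Tree Q) := by
  have : Function.Injective fun t : Tree Q => (t.nodes, t.parent) := by
    rintro ⟨a, b⟩ ⟨c, d⟩ h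
    simpa using h
  exact Finite.of_injective _ this

/-- Almost surely, the tree is eventually an optimal tree. -/
theorem IsRun.ae_eventually_isOptimal {Ω : Type*} [MeasurableSpace Ω] {ℙ : Measure Ω}
    [IsProbabilityMeasure ℙ] {root : QP N W QB} {target : ℕ → Tree (QP N W QB) → QB}
    {root? : Option (QP N W QB)} {θ : SamplingParams N W QB} {ε : ℝ} (hε : 0 < ε)
    (hθ : θ.Admissible ε) {X : ℕ → Ω → Tree (QP N W QB)}
    (hX : IsRun ℙ (Tree.init root) (treeStep S B target root? θ) X) :
    ∀ᵐ ω ∂ℙ, ∀ᶠ n in atTop, (X n ω).Inv (pbaTrans S B) (pbaWeight S) root ∧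
      (X n ω).IsOptimal (pbaTrans S B) (pbaWeight S) root := by
  have := finite_tree (QP N W QB)
  refine hX.ae_eventually_mem (le := Tree.Le (pbaWeight S))
    (I := Tree.Inv (pbaTrans S B) (pbaWeight S) root)
    (G := Tree.IsOptimal (pbaTrans S B) (pbaWeight S) root)
    Tree.Le.refl Tree.Le.trans (Tree.inv_init (pbaWeight_nonneg S) root) ?_
    (fun _ _ h hle => h.mono hle) (sampleBound_ne_zero N W QB hε) (hθ.2.2.mono ?_)
  · intro n t t' ht htt
    rcases eq_or_eq_update_of_treeStep_ne_zero S B htt with rfl | ⟨x, rfl⟩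
    · exact ⟨ht, Tree.Le.refl _⟩
    · exact ⟨(ht.update x).1, (ht.update x).2.1⟩
  · intro n hn t ht hno
    obtain ⟨u, hu, v, huv, hle⟩ := ht.exists_improvement hno
    exact ⟨_, hle, le_treeStep S B hθ (hn t) hu huv⟩

end Sampling

/-! ### Lassos -/

section Lasso

variable {α : Type} {r : α → α → Prop}

/-- The infinite sequence that first follows `pre` and then goes around the cycle `suf`, which
starts and ends at the last element of `pre`. -/
def lasso (pre suf : List α) (d : α) (n : ℕ) : α :=
  if n < pre.length then pre.getD n d
  else suf.getD ((n - pre.length) % (suf.length - 1) + 1) d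

theorem isChain_getD {l : List α} (h : l.IsChain r) (d : α) {i : ℕ} (hi : i + 1 < l.length) :
    r (l.getD i d) (l.getD (i + 1) d) := by
  have := List.isChain_iff_getElem.1 h i hi
  rwa [List.getD_eq_getElem _ _ hi, List.getD_eq_getElem _ _ (by omega)]

theorem getD_of_head? {l : List α} {f d : α} (h : l.head? = some f) : l.getD 0 d = f := by
  cases l <;> simp_all

theorem getD_of_getLast? {l : List α} {f d : α} (h : l.getLast? = some f) :
    l.getD (l.length - 1) d = f := by
  rw [List.getLast?_eq_getElem?] at h
  rw [List.getD_eq_getElem?_getD, h]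
  rfl

variable {pre suf : List α} {a f d : α}

theorem lasso_zero (h : pre.head? = some a) : lasso pre suf d 0 = a := by
  have : 0 < pre.length := by cases pre <;> simp_all
  rw [lasso, if_pos this, getD_of_head? h]

/-- Entering the cycle and closing it are the same step: from `f` to the entry of `suf` with index
1, index 0 being a copy of `f` that is skipped. -/
theorem lasso_step (h2 : pre.getLast? = some f) (h3 : pre.IsChain r) (h4 : 2 ≤ suf.length)
    (h5 : suf.head? = some f) (h6 : suf.getLast? = some f) (h7 : suf.IsChain r) (n : ℕ) :
    r (lasso pre suf d n) (lasso pre suf d (n + 1)) := by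
  have e0 : suf.getD 0 d = f := getD_of_head? h5
  have h01 : r f (suf.getD 1 d) := by
    have := isChain_getD h7 d (i := 0) (by omega)
    rwa [e0] at this
  have e1 : pre.getD (pre.length - 1) d = f := getD_of_getLast? h2
  have e2 : suf.getD (suf.length - 1) d = f := getD_of_getLast? h6
  unfold lasso
  rcases lt_trichotomy (n + 1) pre.length with h | h | h
  · rw [if_pos (by omega), if_pos h]
    exact isChain_getD h3 d h
  · rw [if_pos (by omega), if_neg (by omega), ← h, Nat.sub_self, Nat.zero_mod]
    rw [← h, Nat.add_sub_cancel] at e1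
    rw [e1]
    exact h01
  · rw [if_neg (by omega), if_neg (by omega), Nat.sub_add_comm (by omega)]
    set m := suf.length - 1 with hm
    set k := n - pre.length
    have hk : k % m < m := Nat.mod_lt _ (by omega)
    rcases Nat.lt_or_ge (k % m + 1) m with h8 | h8
    · have : (k + 1) % m = k % m + 1 := by
        rw [Nat.add_mod, Nat.mod_eq_of_lt (a := 1) (by omega), Nat.mod_eq_of_lt h8]
      rw [this]
      exact isChain_getD h7 d (by omega)
    · have h9 : k % m + 1 = m := by omega
      have : (k + 1) % m = 0 := by
        rw [Nat.add_mod_eq_add_mod_right 1 (Nat.mod_mod k m).symm, h9, Nat.mod_self]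
      rw [this, h9, e2]
      exact h01

theorem frequently_lasso (h4 : 2 ≤ suf.length) (h6 : suf.getLast? = some f) :
    ∃ᶠ n in atTop, lasso pre suf d n = f := by
  rw [frequently_atTop]
  intro N
  have e2 : suf.getD (suf.length - 1) d = f := getD_of_getLast? h6
  set m := suf.length - 1 with hm
  -- The offset is `m - 1` modulo `m`, which selects the last entry of `suf`; the multiple `m * N`
  -- makes the time large.
  refine ⟨pre.length + (m - 1 + m * N), ?_, ?_⟩
  · have : N ≤ m * N := Nat.le_mul_of_pos_left _ (by omega)
    omega
  · rw [lasso, if_neg (by omega), ← hm, Nat.add_sub_cancel_left, Nat.add_mul_mod_self_left,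
      Nat.mod_eq_of_lt (by omega), Nat.sub_add_cancel (by omega), e2]

theorem isChain_map_range {s : ℕ → α} (hs : ∀ k, r (s k) (s (k + 1))) (n : ℕ) :
    ((List.range n).map s).IsChain r := by
  rw [List.isChain_iff_getElem]
  intro i hi
  simpa using hs i

theorem getLast?_map_range (s : ℕ → α) (n : ℕ) :
    ((List.range (n + 1)).map s).getLast? = some (s n) := by
  simp [List.range_succ]

theorem head?_map_range (s : ℕ → α) (n : ℕ) :
    ((List.range (n + 1)).map s).head? = some (s 0) := by
  simp [List.range_succ_eq_map]

end Lasso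

/-! ### Feasibility of plans in prefix-suffix form -/

section Feasibility

variable {N W : ℕ} {QB : Type} {S : Fin N → WTS W} {B : NBA (AP N W) QB} {φ : LTL (AP N W)}

/-- The automaton part of the lasso in the product is a run on the trace of the plan, and it returns
to the accepting part of `f` forever. -/
theorem IsPrefixSuffix.isFeasiblePlan (hB : ∀ σ, B.Accepts σ ↔ φ.Sat σ) {P : Plan N W}
    (h : IsPrefixSuffix S B P) : IsFeasiblePlan S B φ P := by
  refine ⟨h, ?_⟩
  obtain ⟨ppre, psuf, b₀, f, hpre, hsuf, hb₀, hf, h1, h2, h3, h4, h5, h6, h7⟩ := h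
  have hrun : ∀ n, P.run S n = (lasso ppre psuf (ptsInit S, b₀) n).1 := by
    intro n
    -- The default `(ptsInit S, b₀)` projects to the default of `Plan.run`, so no index bounds are
    -- needed.
    have hmap : ∀ (l : List (QP N W QB)) k, (l.map Prod.fst).getD k (ptsInit S) =
        (l.getD k (ptsInit S, b₀)).1 := fun l k =>
      List.getD_map (f := (Prod.fst : QP N W QB → QPTS N W)) (d := (ptsInit S, b₀)) ..
    rw [Plan.run, lasso, hpre, hsuf, List.length_map, List.length_map]
    split_ifs <;> exact hmap _ _
  have hstep := lasso_step (d := (ptsInit S, b₀)) h2 h3 h4 h5 h6 h7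
  have hzero := lasso_zero (suf := psuf) (d := (ptsInit S, b₀)) h1
  refine ⟨⟨by rw [hrun, hzero], fun k => ?_⟩, ?_⟩
  · rw [hrun, hrun]
    exact (hstep k).1
  · rw [Models, ← hB]
    refine ⟨fun k => (lasso ppre psuf (ptsInit S, b₀) k).2, by
      beta_reduce; rwa [hzero], fun k => ?_, ?_⟩
    · beta_reduce
      rw [hrun]
      exact (hstep k).2
    · exact (frequently_lasso (pre := ppre) (d := (ptsInit S, b₀)) h4 h6).mono fun n hn => by
        beta_reduce; rwa [hn]

theorem exists_isPrefixSuffix [Finite QB] (hB : ∀ σ, B.Accepts σ ↔ φ.Sat σ)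
    (hsol : ∃ τ : ℕ → QPTS N W, IsPTSPath S τ ∧ Models τ φ) :
    ∃ P : Plan N W, IsPrefixSuffix S B P := by
  obtain ⟨τ, ⟨h0, hτ⟩, hm⟩ := hsol
  obtain ⟨ρ, hρ0, hρ, hfin⟩ := (hB _).2 hm
  let s : ℕ → QP N W QB := fun k => (τ k, ρ k)
  have hs : ∀ k, pbaTrans S B (s k) (s (k + 1)) := fun k => ⟨hτ k, hρ k⟩
  -- Pigeonhole over the finite product: some accepting product state recurs infinitely often. Two
  -- of its visits cut out a prefix and a cycle.
  obtain ⟨f, hf, hff⟩ : ∃ f : QP N W QB, f.2 ∈ B.final ∧ ∃ᶠ k in atTop, s k = f := by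
    by_contra! hcon
    have : ∀ᶠ k in atTop, ∀ f : QP N W QB, f.2 ∈ B.final → s k ≠ f := by
      rw [eventually_all]
      intro f
      by_cases hf : f.2 ∈ B.final
      · exact (hcon f hf).mono fun k hk _ => hk
      · exact Eventually.of_forall fun k h => absurd h hf
    obtain ⟨k, hk, hk'⟩ := (hfin.and_eventually this).exists
    exact hk' (s k) hk rfl
  obtain ⟨i, -, hi⟩ := frequently_atTop.1 hff 0
  obtain ⟨j, hij, hj⟩ := frequently_atTop.1 hff (i + 1)
  obtain ⟨m, rfl⟩ : ∃ m, j = i + (m + 1) := ⟨j - i - 1, by omega⟩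
  refine ⟨⟨_, _⟩, (List.range (i + 1)).map s, (List.range (m + 1 + 1)).map fun k => s (i + k),
    ρ 0, f, rfl, rfl, hρ0, hf, ?_, ?_, isChain_map_range hs _, by simp, ?_, ?_,
    isChain_map_range (fun k => hs (i + k)) _⟩
  · rw [head?_map_range, ← h0]
  · rw [getLast?_map_range, hi]
  · rw [head?_map_range, Nat.add_zero, hi]
  · rw [getLast?_map_range, hj]

theorem feasibleSymbol_label (q : QPTS N W) : FeasibleSymbol (label q) :=
  fun _ _ _ h h' => Eq.trans (Eq.symm h) h'

theorem feasEdge_of_pbaTrans {p p' : QP N W QB} (h : pbaTrans S B p p') :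
    feasEdge B p.2 p'.2 := ⟨_, feasibleSymbol_label _, h.2⟩

theorem reflTransGen_of_isChain {l : List (QP N W QB)} {a v : QP N W QB}
    (h : (a :: l).IsChain (pbaTrans S B)) (hv : (a :: l).getLast? = some v) :
    Relation.ReflTransGen (feasEdge B) a.2 v.2 := by
  induction l generalizing a with
  | nil =>
    obtain rfl : a = v := by simpa using hv
    exact .refl
  | cons b l ih =>
    rw [List.isChain_cons_cons] at h
    exact .head (feasEdge_of_pbaTrans h.1) (ih h.2 (by simpa using hv))

theorem hopDist_ne_top {α : Type} {r : α → α → Prop} {a b : α}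
    (h : Relation.ReflTransGen r a b) : hopDist r a b ≠ ⊤ := by
  obtain ⟨n, hn⟩ : ∃ n, StepsIn r n a b := by
    induction h using Relation.ReflTransGen.head_induction_on with
    | refl => exact ⟨0, rfl⟩
    | head h _ ih =>
      obtain ⟨n, hn⟩ := ih
      exact ⟨n + 1, _, h, hn⟩
  exact ne_top_of_le_ne_top (ENat.natCast_ne_top n) (sInf_le ⟨n, rfl, hn⟩)

end Feasibility

/-! ### Extraction from optimal trees -/

section Extraction

variable {N W : ℕ} {QB : Type} {S : Fin N → WTS W} {B : NBA (AP N W) QB}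

theorem pathCost_map_fst (l : List (QP N W QB)) :
    pathCost (ptsWeight S) (l.map Prod.fst) = pathCost (pbaWeight S) l := by
  induction l with
  | nil => simp [pathCost]
  | cons a l ih =>
    cases l with
    | nil => simp [pathCost]
    | cons b l =>
      simp only [List.map_cons, pathCost_cons_cons] at ih ⊢
      rw [ih]
      rfl

/-- The trees are correct, and optimal. -/
structure OptimalTrees (S : Fin N → WTS W) (B : NBA (AP N W) QB) (tpre : QB → Tree (QP N W QB))
    (tsuf : QB → QP N W QB → Tree (QP N W QB)) : Prop where
  pre : ∀ b₀ ∈ B.init, (∃ f, IsFeasibleFinal B b₀ f) →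
    (tpre b₀).Inv (pbaTrans S B) (pbaWeight S) (ptsInit S, b₀) ∧
      (tpre b₀).IsOptimal (pbaTrans S B) (pbaWeight S) (ptsInit S, b₀)
  suf : ∀ b₀ ∈ B.init, ∀ ρ : QP N W QB, ρ.2 ∈ B.final →
    (tsuf b₀ ρ).Inv (pbaTrans S B) (pbaWeight S) ρ ∧
      (tsuf b₀ ρ).IsOptimal (pbaTrans S B) (pbaWeight S) ρ

theorem suffixTree_inv {ρ : QP N W QB} {t : Tree (QP N W QB)}
    (h : t.Inv (pbaTrans S B) (pbaWeight S) ρ) :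
    (suffixTree S B ρ t).Inv (pbaTrans S B) (pbaWeight S) ρ := by
  unfold suffixTree
  split_ifs
  · exact Tree.inv_init (pbaWeight_nonneg S) ρ
  · exact h

/-- Removing the last edge of a cycle leaves a path from `ρ` to some `s`, which the tree path to `s`
can replace at no larger cost. If the suffix tree is trivial, its self-loop already has cost zero.
-/
theorem exists_goalSuf_le {ρ : QP N W QB} {t : Tree (QP N W QB)}
    (h : t.Inv (pbaTrans S B) (pbaWeight S) ρ)
    (ho : t.IsOptimal (pbaTrans S B) (pbaWeight S) ρ) {l : List (QP N W QB)} (hl : 2 ≤ l.length)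
    (hhead : l.head? = some ρ) (hlast : l.getLast? = some ρ) (hc : l.IsChain (pbaTrans S B)) :
    ∃ p ∈ goalSuf S B ρ (suffixTree S B ρ t),
      pathCost (pbaWeight S) ((suffixTree S B ρ t).findPath p ++ [ρ]) ≤
        pathCost (pbaWeight S) l := by
  unfold suffixTree
  split_ifs with h0
  · have hi := Tree.inv_init (r := pbaTrans S B) (pbaWeight_nonneg S) ρ
    refine ⟨ρ, ⟨hi.root_path.mem_nodes, h0.1⟩, ?_⟩
    rw [hi.root_path.findPath_eq, hi.root_path.pathCost_step, pathCost_singleton, h0.2, zero_add]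
    exact pathCost_nonneg (pbaWeight_nonneg S) l
  · obtain ⟨l₀, rfl⟩ : ∃ l₀, l = l₀ ++ [ρ] := by
      rw [List.getLast?_eq_some_iff] at hlast
      exact hlast
    obtain ⟨m, rfl⟩ : ∃ m, l₀ = ρ :: m := by
      cases l₀ with
      | nil => simp at hl
      | cons a m =>
        obtain rfl : a = ρ := by simpa using hhead
        exact ⟨m, rfl⟩
    obtain ⟨s, hs⟩ : ∃ s, (ρ :: m).getLast? = some s := ⟨_, List.getLast?_eq_some_getLast (by simp)⟩
    obtain ⟨hc1, -, hc2⟩ := List.isChain_append.1 hc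
    have hsr : pbaTrans S B s ρ := hc2 s (by simpa using hs) ρ (by simp)
    obtain ⟨hsn, hcost⟩ := ho m s hc1 hs
    obtain ⟨ls, hls⟩ := h.paths s hsn
    refine ⟨s, ⟨hsn, hsr⟩, ?_⟩
    rw [hls.findPath_eq, hls.pathCost_step, ← hls.cost_eq]
    obtain ⟨l₁, hl₁⟩ := List.getLast?_eq_some_iff.1 hs
    rw [hl₁] at hcost ⊢
    rw [pathCost_append_append]
    linarith

variable {tpre : QB → Tree (QP N W QB)} {tsuf : QB → QP N W QB → Tree (QP N W QB)}

theorem OptimalTrees.isPrefixSuffix (hT : OptimalTrees S B tpre tsuf) {P : Plan N W}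
    (hP : IsCandidatePlan S B tpre tsuf P) : IsPrefixSuffix S B P := by
  obtain ⟨b₀, hb₀, ρ, ⟨hff, hρ, hρf⟩, l, ⟨p, ⟨hp, hpr⟩, rfl, -⟩, hpre, hsuf⟩ := hP
  obtain ⟨l₁, h₁⟩ := (hT.pre b₀ hb₀ hff).1.paths ρ hρ
  have hi := suffixTree_inv (hT.suf b₀ hb₀ ρ hρf).1
  obtain ⟨l₂, h₂⟩ := hi.paths p hp
  rw [h₁.findPath_eq] at hpre
  rw [h₂.findPath_eq] at hsuf
  refine ⟨l₁, l₂ ++ [ρ], b₀, ρ, hpre, hsuf, hb₀, hρf, h₁.head?_eq, h₁.getLast?_eq, h₁.isChain,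
    ?_, ?_, by simp, ?_⟩
  · obtain ⟨l₀, rfl⟩ := h₂.exists_eq_append
    simp
  · rw [List.head?_append, h₂.head?_eq]
    rfl
  · refine List.isChain_append.2 ⟨h₂.isChain, by simp, ?_⟩
    rw [h₂.getLast?_eq]
    simpa using hpr

theorem OptimalTrees.exists_candidate_le [Finite QB] (hT : OptimalTrees S B tpre tsuf) {β : ℝ}
    (hβ : β ∈ Set.Icc (0 : ℝ) 1) {P' : Plan N W} (hP : IsPrefixSuffix S B P') :
    ∃ P, IsCandidatePlan S B tpre tsuf P ∧ P.cost S β ≤ P'.cost S β := by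
  obtain ⟨ppre, psuf, b₀, f, hpre, hsuf, hb₀, hf, h1, h2, h3, h4, h5, h6, h7⟩ := hP
  obtain ⟨m, rfl⟩ : ∃ m, ppre = (ptsInit S, b₀) :: m := by
    cases ppre with
    | nil => simp at h1
    | cons a m =>
      obtain rfl : a = (ptsInit S, b₀) := by simpa using h1
      exact ⟨m, rfl⟩
  -- This guarantees that the prefix tree for `b₀` is built: team labels are feasible symbols, so
  -- paths and cycles of the product project to the pruned automaton.
  have hff : IsFeasibleFinal B b₀ f.2 := by
    refine ⟨hf, hopDist_ne_top (reflTransGen_of_isChain h3 h2), ?_⟩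
    match psuf, h4, h5, h6, h7 with
    | a :: b :: l, _, h5, h6, h7 =>
      obtain rfl : a = f := by simpa using h5
      rw [List.isChain_cons_cons] at h7
      exact .head' (feasEdge_of_pbaTrans h7.1)
        (reflTransGen_of_isChain h7.2 (by simpa using h6))
  obtain ⟨hi, ho⟩ := hT.pre b₀ hb₀ ⟨_, hff⟩
  obtain ⟨hfn, hcost⟩ := ho m f h3 h2
  obtain ⟨hi', ho'⟩ := hT.suf b₀ hb₀ f hf
  obtain ⟨s, hs, hsle⟩ := exists_goalSuf_le hi' ho' h4 h5 h6 h7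
  set T := suffixTree S B f (tsuf b₀ f)
  obtain ⟨p, hp, hmin⟩ := Set.exists_min_image (goalSuf S B f T)
    (fun p => pathCost (pbaWeight S) (T.findPath p ++ [f])) (Set.toFinite _) ⟨s, hs⟩
  refine ⟨⟨((tpre b₀).findPath f).map Prod.fst, (T.findPath p ++ [f]).map Prod.fst⟩,
    ⟨b₀, hb₀, f, ⟨⟨_, hff⟩, hfn, hf⟩, _, ⟨p, hp, rfl, hmin⟩, rfl, rfl⟩, ?_⟩
  simp only [Plan.cost, hpre, hsuf, pathCost_map_fst]
  refine add_le_add (mul_le_mul_of_nonneg_left hcost hβ.1)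
    (mul_le_mul_of_nonneg_left ((hmin s hs).trans hsle) (by linarith [hβ.2]))

/-- A candidate is determined by `b₀`, `ρ` and the node that closes the cycle. Finiteness ensures
that a cheapest candidate exists. -/
theorem finite_isCandidatePlan [Finite QB] (S : Fin N → WTS W) (B : NBA (AP N W) QB)
    (tpre : QB → Tree (QP N W QB)) (tsuf : QB → QP N W QB → Tree (QP N W QB)) :
    {P | IsCandidatePlan S B tpre tsuf P}.Finite := by
  refine (Set.finite_range fun x : QB × QP N W QB × QP N W QB =>
    (⟨((tpre x.1).findPath x.2.1).map Prod.fst,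
      ((suffixTree S B x.2.1 (tsuf x.1 x.2.1)).findPath x.2.2 ++ [x.2.1]).map Prod.fst⟩ :
        Plan N W)).subset ?_
  rintro ⟨pre, suf⟩ ⟨b₀, -, ρ, -, l, ⟨p, -, rfl, -⟩, hpre, hsuf⟩
  exact ⟨(b₀, ρ, p), by simp only at hpre hsuf; rw [hpre, hsuf]⟩

/-- With optimal trees, there is an output, and every output is an optimal plan. -/
theorem OptimalTrees.output_isOptimalPlan [Finite QB] {φ : LTL (AP N W)}
    (hB : ∀ σ, B.Accepts σ ↔ φ.Sat σ)
    (hsol : ∃ τ : ℕ → QPTS N W, IsPTSPath S τ ∧ Models τ φ)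
    (hT : OptimalTrees S B tpre tsuf) {β : ℝ} (hβ : β ∈ Set.Icc (0 : ℝ) 1) :
    (∃ P, IsOutput S B β tpre tsuf P) ∧
      ∀ P, IsOutput S B β tpre tsuf P → IsOptimalPlan S B φ β P := by
  constructor
  · obtain ⟨P', hP'⟩ := exists_isPrefixSuffix hB hsol
    obtain ⟨P, hP, -⟩ := hT.exists_candidate_le hβ hP'
    exact Set.exists_min_image _ (fun P => P.cost S β) (finite_isCandidatePlan S B tpre tsuf)
      ⟨P, hP⟩
  · rintro P ⟨hP, hmin⟩
    refine ⟨(hT.isPrefixSuffix hP).isFeasiblePlan hB, fun P' hP' => ?_⟩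
    obtain ⟨P'', h1, h2⟩ := hT.exists_candidate_le hβ hP'.1
    exact (hmin _ h1).trans h2

end Extraction

/-- Almost surely, all trees of the algorithm are eventually optimal. -/
theorem IsAlgorithmRun.ae_eventually_optimalTrees {N W : ℕ} {QB : Type} {Ω : Type*} [Fintype QB]
    [MeasurableSpace Ω] {ℙ : Measure Ω} [IsProbabilityMeasure ℙ] {S : Fin N → WTS W}
    {B : NBA (AP N W) QB} {target : QB → ℕ → Tree (QP N W QB) → QB}
    {θpre : QB → SamplingParams N W QB} {θsuf : QB → QP N W QB → SamplingParams N W QB}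
    {ε : ℝ} (hε : 0 < ε) (hθpre : ∀ b₀, (θpre b₀).Admissible ε)
    (hθsuf : ∀ b₀ ρ, (θsuf b₀ ρ).Admissible ε) {Xpre : QB → ℕ → Ω → Tree (QP N W QB)}
    {Xsuf : QB → QP N W QB → ℕ → Ω → Tree (QP N W QB)}
    (hX : IsAlgorithmRun ℙ S B target θpre θsuf Xpre Xsuf) :
    ∀ᵐ ω ∂ℙ, ∀ᶠ n : ℕ × ℕ in atTop,
      OptimalTrees S B (fun b₀ => Xpre b₀ n.1 ω) (fun b₀ ρ => Xsuf b₀ ρ n.2 ω) := by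
  have hpre : ∀ᵐ ω ∂ℙ, ∀ b₀, b₀ ∈ B.init → (∃ f, IsFeasibleFinal B b₀ f) → ∀ᶠ n in atTop,
      (Xpre b₀ n ω).Inv (pbaTrans S B) (pbaWeight S) (ptsInit S, b₀) ∧
        (Xpre b₀ n ω).IsOptimal (pbaTrans S B) (pbaWeight S) (ptsInit S, b₀) := by
    simp only [ae_all_iff]
    exact fun b₀ hb₀ hf => (hX.pre b₀ hb₀ hf).ae_eventually_isOptimal S B hε (hθpre b₀)
  have hsuf : ∀ᵐ ω ∂ℙ, ∀ b₀, b₀ ∈ B.init → ∀ ρ : QP N W QB, ρ.2 ∈ B.final → ∀ᶠ n in atTop,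
      (Xsuf b₀ ρ n ω).Inv (pbaTrans S B) (pbaWeight S) ρ ∧
        (Xsuf b₀ ρ n ω).IsOptimal (pbaTrans S B) (pbaWeight S) ρ := by
    simp only [ae_all_iff]
    exact fun b₀ hb₀ ρ hρ => (hX.suf b₀ hb₀ ρ hρ).ae_eventually_isOptimal S B hε (hθsuf b₀ ρ)
  filter_upwards [hpre, hsuf] with ω h1 h2
  rw [← prod_atTop_atTop_eq]
  -- Only finitely many trees occur, so one bound serves all prefix trees and one all suffix trees.
  -- Their joint distribution plays no role, since only null sets are combined.
  simp only [← eventually_all] at h1 h2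
  filter_upwards [tendsto_fst.eventually h1, tendsto_snd.eventually h2] with n h3 h4
  exact ⟨h3, h4⟩

end Stylus

end

theorem mainTheorem3 {N W : ℕ} {QB : Type} {Ω : Type*} [Fintype QB]
    (S : Fin N → Stylus.WTS W)
    (φ : Stylus.LTL (Stylus.AP N W))
    (B : Stylus.NBA (Stylus.AP N W) QB)
    (hB : ∀ σ : ℕ → Set (Stylus.AP N W), B.Accepts σ ↔ φ.Sat σ)
    (β : ℝ) (hβ : β ∈ Set.Icc (0 : ℝ) 1)
    (target : QB → ℕ → Stylus.Tree (Stylus.QP N W QB) → QB)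
    (θpre : QB → Stylus.SamplingParams N W QB)
    (θsuf : QB → Stylus.QP N W QB → Stylus.SamplingParams N W QB)
    (ε : ℝ) (hε : 0 < ε)
    (hθpre : ∀ b₀, (θpre b₀).Admissible ε)
    (hθsuf : ∀ b₀ ρ, (θsuf b₀ ρ).Admissible ε)
    [MeasurableSpace Ω] (ℙ : MeasureTheory.Measure Ω) [MeasureTheory.IsProbabilityMeasure ℙ]
    (Xpre : QB → ℕ → Ω → Stylus.Tree (Stylus.QP N W QB))
    (Xsuf : QB → Stylus.QP N W QB → ℕ → Ω → Stylus.Tree (Stylus.QP N W QB))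
    (hX : Stylus.IsAlgorithmRun ℙ S B target θpre θsuf Xpre Xsuf)
    (hsol : ∃ τ : ℕ → Stylus.QPTS N W, Stylus.IsPTSPath S τ ∧ Stylus.Models τ φ) :
    (∀ᵐ ω ∂ℙ, ∀ᶠ n : ℕ × ℕ in Filter.atTop,
      (∃ P, Stylus.IsOutput S B β (fun b₀ => Xpre b₀ n.1 ω) (fun b₀ ρ => Xsuf b₀ ρ n.2 ω) P) ∧
      ∀ P, Stylus.IsOutput S B β (fun b₀ => Xpre b₀ n.1 ω) (fun b₀ ρ => Xsuf b₀ ρ n.2 ω) P →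
        Stylus.IsFeasiblePlan S B φ P) ∧
    (∀ᵐ ω ∂ℙ, ∀ᶠ n : ℕ × ℕ in Filter.atTop,
      (∃ P, Stylus.IsOutput S B β (fun b₀ => Xpre b₀ n.1 ω) (fun b₀ ρ => Xsuf b₀ ρ n.2 ω) P) ∧
      ∀ P, Stylus.IsOutput S B β (fun b₀ => Xpre b₀ n.1 ω) (fun b₀ ρ => Xsuf b₀ ρ n.2 ω) P →
        Stylus.IsOptimalPlan S B φ β P) := by
  have h := hX.ae_eventually_optimalTrees hε hθpre hθsuf
  have hopt := h.mono fun ω hω => hω.mono fun n hn => hn.output_isOptimalPlan hB hsol hβ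
  -- Completeness is read off from optimality, because an optimal plan is feasible by definition.
  exact ⟨hopt.mono fun ω hω => hω.mono fun n hn => ⟨hn.1, fun P hP => (hn.2 P hP).1⟩, hopt⟩
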